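/- Random sequential covering by dimers. For an integer $L\ge 0$ start with the interval of sites $\{1,\dots,L\}$, all uncovered. The dimer labelled $k\in\{1,\dots,L+1\}$ covers the two sites $k-1$ and $k$ (so it may overhang the interval by one site). Dimers are deposited one after another; at each step the next dimer is chosen uniformly at random among those that cover at least one still uncovered site of $\{1,\dots,L\}$. The process stops when all sites are covered. Let $N=N_L$ be the total number of deposited dimers (so $N_0=0$), let $F(\lambda,L)=\langle e^{\lambda N_L}\rangle$ for real $\lambda$, and let the cumulants $\langle N^n\rangle_c$ be defined by $\ln\langle e^{\lambda N}\rangle=\sum_{n\ge1}\frac{\lambda^n}{n!}\langle N^n\rangle_c$ near $\lambda=0$. For real $\lambda$ put $$\Lambda=e^{\lambda/2}\sqrt{1-e^{\lambda}},\qquad y(\lambda)=\frac{\arctan\big(e^{-\lambda/2}\sqrt{1-e^\lambda}\big)}{e^{\lambda/2}\sqrt{1-e^\lambda}}\quad(\lambda\ne0),\qquad y(0)=1,$$ with principal branches of the complex square root and arctangent, and $U(\lambda)=-\ln y(\lambda)$. Then: 1. All exponential moments of $N_L$ are finite; for every real $\lambda$ the number $y(\lambda)$ is real and positive, and $y(\lambda)\to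 y(0)=1$ as $\lambda\to0$. 2. For real $\lambda\neq0$ and complex $x$ with $|x|<y(\lambda)$ and $\cos(\Lambda x)\ne0$, the denominator below does not vanish, the series converges and $$\Phi(\lambda,x):=\sum_{L\ge0}F(\lambda,L)\,x^{L+1}=\frac{\tan(\Lambda x)}{\Lambda-e^{\lambda}\tan(\Lambda x)}.$$ For $\lambda=0$ and $|x|<1$ one has $\Phi(0,x)=\frac{x}{1-x}$, which is the limit of the right-hand side as $\lambda\to0$. 3. As a meromorphic function of $x$, the closed form of $\Phi(\lambda,\cdot)$ in part 2 has a simple pole at $x=y(\lambda)$, for every real $\lambda$. 4. For every real $\lambda$, $\displaystyle\lim_{L\to\infty}\frac{\ln\langle e^{\lambda N_L}\rangle}{L}=U(\lambda)=-\ln y(\lambda)$. 5. $U$ is real-analytic at $0$, and for every $n\ge1$, $\displaystyle\lim_{L\to\infty}\frac{\langle N_L^n\rangle_c}{L}=U^{(n)}(0)$. In particular, as $L\to\infty$, $$\frac{\langle N\rangle}{L}\to\frac23,\qquad \frac{\langle N^2\rangle_c}{L}=\frac{\operatorname{Var}N}{L}\to\frac{2}{45},\qquad \frac{\langle N^3\rangle_c}{L}\to\frac{2}{945},\qquad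 \frac{\langle N^4\rangle_c}{L}\to-\frac{22}{4725}.$$ 6. The Mandel parameter satisfies $\displaystyle Q_L=\frac{\operatorname{Var}N_L}{\langle N_L\rangle}-1\to-\frac{14}{15}$ as $L\to\infty$. -/

import Mathlib

open Filter Topology MeasureTheory ProbabilityTheory

noncomputable section

namespace DimerCovering

/-- The dimer with label `k ≥ 1` occupies the two lattice sites `k - 1` and `k`. -/
def dimer (k : ℕ) : Finset ℕ := {k - 1, k}

/-- The labels `k ∈ {1, …, L + 1}` of the dimers whose deposition is accepted when `U` is the set
of uncovered sites of the interval `{1, …, L}`: those that cover at least one site of `U`. -/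
def admissible (L : ℕ) (U : Finset ℕ) : Finset ℕ :=
  (Finset.Icc 1 (L + 1)).filter fun k => ¬ Disjoint (dimer k) U

lemma card_sdiff_dimer_lt {L : ℕ} {U : Finset ℕ} {k : ℕ} (hk : k ∈ admissible L U) :
    (U \ dimer k).card < U.card := by
  have h := (Finset.mem_filter.mp hk).2
  obtain ⟨a, ha, haU⟩ := Finset.not_disjoint_iff.mp h
  refine Finset.card_lt_card ⟨Finset.sdiff_subset, fun hs => ?_⟩
  exact (Finset.mem_sdiff.mp (hs haU)).2 ha

/-- The law of the random sequence of labels of the dimers that are deposited from the moment when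
the uncovered sites are exactly those in `U`: as long as some deposition is accepted, the next
dimer is chosen uniformly among the accepted ones; otherwise the process stops. -/
def history (L : ℕ) (U : Finset ℕ) : PMF (List ℕ) :=
  if h : (admissible L U).Nonempty then
    (PMF.uniformOfFinset (admissible L U) h).bindOnSupport fun k _hk =>
      (history L (U \ dimer k)).map (List.cons k)
  else PMF.pure []
termination_by U.card
decreasing_by
  exact card_sdiff_dimer_lt ((PMF.mem_support_uniformOfFinset_iff h k).mp _hk)

/-- The law of the number `N` of dimers in the congested configuration reached from the empty
interval `{1, …, L}`. -/
def countPMF (L : ℕ) : PMF ℕ := (history L (Finset.Icc 1 L)).map List.length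

/-- The same law as a measure on `ℕ`. -/
def countLaw (L : ℕ) : Measure ℕ := (countPMF L).toMeasure

/-- The number `N` as a real random variable on the probability space `(ℕ, countLaw L)`. -/
def count (n : ℕ) : ℝ := n

/-- `F(λ, L) = ⟨e^{λN}⟩`. -/
def F (lam : ℝ) (L : ℕ) : ℝ := mgf count (countLaw L) lam

/-- The `n`-th cumulant of a real random variable: the `n`-th Taylor coefficient (times `n!`) at
`0` of its cumulant generating function `λ ↦ ln E[e^{λX}]`. -/
def cumulant {Ω : Type*} [MeasurableSpace Ω] (n : ℕ) (X : Ω → ℝ) (μ : Measure Ω) : ℝ :=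
  iteratedDeriv n (cgf X μ) 0

/-- The Mandel parameter of `N` on the interval of length `L`: variance over mean, minus one. -/
def mandelQ (L : ℕ) : ℝ :=
  Var[count; countLaw L] / (∫ n, count n ∂(countLaw L)) - 1

/-- The principal square root `√(1 - e^λ)`, which is imaginary for `λ > 0`. -/
def root (lam : ℝ) : ℂ := (1 - Complex.exp lam) ^ (1 / 2 : ℂ)

/-- `Λ = e^{λ/2} √(1 - e^λ)`. -/
def Lam (lam : ℝ) : ℂ := Complex.exp (lam / 2) * root lam

/-- The closed form `tan(Λx) / (Λ - e^λ tan(Λx))`, used for `λ ≠ 0`. -/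
def closedForm (lam : ℝ) (x : ℂ) : ℂ :=
  Complex.tan (Lam lam * x) / (Lam lam - Complex.exp lam * Complex.tan (Lam lam * x))

/-- `y(λ) = arctan(e^{-λ/2} √(1 - e^λ)) / (e^{λ/2} √(1 - e^λ))` for `λ ≠ 0`, and `y(0) = 1`.
The quotient is a real number; the theorem asserts this as well. -/
def y (lam : ℝ) : ℝ :=
  if lam = 0 then 1 else (Complex.arctan (Complex.exp (-lam / 2) * root lam) / Lam lam).re

/-- `U(λ) = -ln y(λ)`. -/
def U (lam : ℝ) : ℝ := -Real.log (y lam)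

end DimerCovering

end

/-!
Conditioning on the first dimer, which splits the uncovered interval into two independent ones,
gives a quadratic recursion for `F(λ, L)`. For `Ψ = 1 + Φ` it reads `Ψ' = e^λ Ψ² + (1 - e^λ)`,
`Ψ(0) = 1`, a Riccati equation solved by a shifted cotangent, whose pole nearest to the origin is
`y(λ)` and is simple with residue `-e^{-λ}`. Subtracting that pole and estimating the remainder on
a larger circle gives `e^λ y(λ)^{L+2} F(λ, L) → 1`. Since this holds uniformly for complex `λ`
near `0`, the holomorphic functions `ln F(λ, L) / L` converge uniformly there to `-ln y(λ)`, and
so do all their derivatives at `0`, the cumulants per site. The values of the derivatives follow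
by applying Leibniz' rule to the linear equation `2 e^λ (y + y') - y - 2 y' = 1`.
-/

noncomputable section

namespace DimerCovering

section Combinatorics

open scoped ENNReal

lemma tsum_pmf_bind_mul {α β : Type*} (p : PMF α) (f : α → PMF β) (g : β → ℝ≥0∞) :
    ∑' b, p.bind f b * g b = ∑' a, p a * ∑' b, f a b * g b := by
  simp_rw [PMF.bind_apply, ← ENNReal.tsum_mul_right, ← ENNReal.tsum_mul_left, mul_assoc]
  exact ENNReal.tsum_comm

lemma tsum_pmf_pure_mul {α : Type*} (a : α) (g : α → ℝ≥0∞) :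
    ∑' b, PMF.pure a b * g b = g a := by
  rw [tsum_eq_single a fun b hb => by rw [PMF.pure_apply_of_ne _ _ hb, zero_mul],
    PMF.pure_apply_self, one_mul]

lemma tsum_pmf_map_mul {α β : Type*} (p : PMF α) (f : α → β) (g : β → ℝ≥0∞) :
    ∑' b, p.map f b * g b = ∑' a, p a * g (f a) := by
  simp_rw [PMF.map, tsum_pmf_bind_mul, Function.comp_apply, tsum_pmf_pure_mul]

lemma mem_admissible {L k : ℕ} {U : Finset ℕ} :
    k ∈ admissible L U ↔ (1 ≤ k ∧ k ≤ L + 1) ∧ (k - 1 ∈ U ∨ k ∈ U) := by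
  simp only [admissible, Finset.mem_filter, Finset.mem_Icc, dimer, Finset.not_disjoint_iff,
    Finset.mem_insert, Finset.mem_singleton, exists_eq_or_imp, exists_eq_left]

lemma admissible_union (L : ℕ) (U V : Finset ℕ) :
    admissible L (U ∪ V) = admissible L U ∪ admissible L V := by
  ext k
  simp only [Finset.mem_union, mem_admissible]
  tauto

lemma admissible_mono (L : ℕ) : Monotone (admissible L) := by
  intro U V hUV k
  simp only [mem_admissible]
  exact And.imp_right (Or.imp (@hUV _) (@hUV _))

lemma admissible_Ico {L a n : ℕ} (ha : 1 ≤ a) (hn : 1 ≤ n) (hL : a + n ≤ L + 1) :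
    admissible L (Finset.Ico a (a + n)) = Finset.Ico a (a + (n + 1)) := by
  ext k
  simp only [mem_admissible, Finset.mem_Ico]
  omega

lemma sdiff_dimer_eq_self {L k : ℕ} {U V : Finset ℕ} (hU : k ∈ admissible L U)
    (hV : k ∉ admissible L V) : V \ dimer k = V := by
  rw [mem_admissible] at hU hV
  refine Finset.sdiff_eq_self_of_disjoint (Finset.disjoint_right.2 fun a ha haV => hV ⟨hU.1, ?_⟩)
  simp only [dimer, Finset.mem_insert, Finset.mem_singleton] at ha
  rcases ha with rfl | rfl <;> tauto

lemma Ico_sdiff_dimer {a n j : ℕ} (ha : 1 ≤ a) (hj : j ≤ n) :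
    Finset.Ico a (a + n) \ dimer (a + j)
      = Finset.Ico a (a + (j - 1)) ∪ Finset.Ico (a + j + 1) (a + j + 1 + (n - 1 - j)) := by
  ext k
  simp only [dimer, Finset.mem_sdiff, Finset.mem_union, Finset.mem_Ico, Finset.mem_insert,
    Finset.mem_singleton]
  omega

/-- The probability generating function `E[w ^ N]` of the number `N` of dimers deposited from the
moment when the uncovered sites are those in `U`. Values in `ℝ≥0∞` spare all summability
conditions. -/
def historyPGF (w : ℝ≥0∞) (L : ℕ) (U : Finset ℕ) : ℝ≥0∞ :=
  ∑' l, history L U l * w ^ l.length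

lemma historyPGF_of_admissible_eq_empty {w : ℝ≥0∞} {L : ℕ} {U : Finset ℕ}
    (h : admissible L U = ∅) : historyPGF w L U = 1 := by
  rw [historyPGF, history, dif_neg (Finset.not_nonempty_iff_eq_empty.2 h), tsum_pmf_pure_mul,
    List.length_nil, pow_zero]

lemma card_mul_historyPGF (w : ℝ≥0∞) (L : ℕ) (U : Finset ℕ) :
    ((admissible L U).card : ℝ≥0∞) * historyPGF w L U
      = w * ∑ k ∈ admissible L U, historyPGF w L (U \ dimer k) := by
  rcases (admissible L U).eq_empty_or_nonempty with hU | hU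
  · simp [hU]
  have hcard : ((admissible L U).card : ℝ≥0∞) ≠ 0 := Nat.cast_ne_zero.2 hU.card_pos.ne'
  rw [historyPGF, history, dif_pos hU, PMF.bindOnSupport_eq_bind _
    (fun k => (history L (U \ dimer k)).map (List.cons k)), tsum_pmf_bind_mul,
    tsum_eq_sum (s := admissible L U)
      fun k hk => by rw [PMF.uniformOfFinset_apply_of_notMem hU hk, zero_mul],
    Finset.mul_sum, Finset.mul_sum]
  refine Finset.sum_congr rfl fun k hk => ?_
  rw [PMF.uniformOfFinset_apply_of_mem hU hk, ← mul_assoc,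
    ENNReal.mul_inv_cancel hcard (ENNReal.natCast_ne_top _), one_mul, tsum_pmf_map_mul,
    historyPGF, ← ENNReal.tsum_mul_left]
  refine tsum_congr fun l => ?_
  rw [List.length_cons, pow_succ]
  ring

lemma historyPGF_ne_top {w : ℝ≥0∞} (hw : w ≠ ∞) (L : ℕ) (U : Finset ℕ) :
    historyPGF w L U ≠ ∞ := by
  induction hn : U.card using Nat.strong_induction_on generalizing U with
  | _ n ih =>
    rcases (admissible L U).eq_empty_or_nonempty with hU | hU
    · simp [historyPGF_of_admissible_eq_empty hU]
    intro htop
    have hsum : w * ∑ k ∈ admissible L U, historyPGF w L (U \ dimer k) ≠ ∞ :=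
      ENNReal.mul_ne_top hw (ENNReal.sum_ne_top.2 fun k hk =>
        ih _ (hn ▸ card_sdiff_dimer_lt hk) _ rfl)
    rw [← card_mul_historyPGF, htop, ENNReal.mul_top (by simpa using hU.ne_empty)] at hsum
    exact hsum rfl

lemma sum_historyPGF_union_sdiff_dimer {w : ℝ≥0∞} {L : ℕ} {U V : Finset ℕ}
    (hUV : Disjoint (admissible L U) (admissible L V))
    (hmul : ∀ k ∈ admissible L U,
      historyPGF w L (U \ dimer k ∪ V) = historyPGF w L (U \ dimer k) * historyPGF w L V) :
    ∑ k ∈ admissible L U, historyPGF w L ((U ∪ V) \ dimer k)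
      = (∑ k ∈ admissible L U, historyPGF w L (U \ dimer k)) * historyPGF w L V := by
  rw [Finset.sum_mul]
  refine Finset.sum_congr rfl fun k hk => ?_
  rw [Finset.union_sdiff_distrib, sdiff_dimer_eq_self hk (Finset.disjoint_left.1 hUV hk),
    hmul k hk]

/-- Two regions that no dimer joins are covered independently, up to the interleaving of the two
histories, which does not affect the number of dimers. -/
lemma historyPGF_union {w : ℝ≥0∞} {L : ℕ} {U V : Finset ℕ}
    (hUV : Disjoint (admissible L U) (admissible L V)) :
    historyPGF w L (U ∪ V) = historyPGF w L U * historyPGF w L V := by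
  induction hn : U.card + V.card using Nat.strong_induction_on generalizing U V with
  | _ n ih =>
    by_cases hempty : admissible L U ∪ admissible L V = ∅
    · obtain ⟨hU, hV⟩ := Finset.union_eq_empty.1 hempty
      simp only [historyPGF_of_admissible_eq_empty, admissible_union, hU, hV, Finset.union_empty,
        one_mul]
    have hcard : ((admissible L (U ∪ V)).card : ℝ≥0∞) ≠ 0 := by
      rwa [Nat.cast_ne_zero, Finset.card_ne_zero, Finset.nonempty_iff_ne_empty, admissible_union]
    have hsumU := sum_historyPGF_union_sdiff_dimer (w := w) hUV fun k hk =>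
      ih _ (by have := card_sdiff_dimer_lt hk; omega)
        (hUV.mono_left (admissible_mono L Finset.sdiff_subset)) rfl
    have hsumV := sum_historyPGF_union_sdiff_dimer (w := w) hUV.symm fun k hk =>
      ih _ (by have := card_sdiff_dimer_lt hk; omega)
        (hUV.symm.mono_left (admissible_mono L Finset.sdiff_subset)) rfl
    refine (ENNReal.mul_right_inj hcard (ENNReal.natCast_ne_top _)).1 ?_
    calc ((admissible L (U ∪ V)).card : ℝ≥0∞) * historyPGF w L (U ∪ V)
        = w * ((∑ k ∈ admissible L U, historyPGF w L (U \ dimer k)) * historyPGF w L V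
          + (∑ k ∈ admissible L V, historyPGF w L (V \ dimer k)) * historyPGF w L U) := by
          rw [card_mul_historyPGF, admissible_union, Finset.sum_union hUV, hsumU,
            Finset.union_comm U V, hsumV]
      _ = (w * ∑ k ∈ admissible L U, historyPGF w L (U \ dimer k)) * historyPGF w L V
          + (w * ∑ k ∈ admissible L V, historyPGF w L (V \ dimer k)) * historyPGF w L U := by ring
      _ = ((admissible L (U ∪ V)).card : ℝ≥0∞) * (historyPGF w L U * historyPGF w L V) := by
          rw [← card_mul_historyPGF, ← card_mul_historyPGF, admissible_union,
            Finset.card_union_of_disjoint hUV, Nat.cast_add]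
          ring

lemma historyPGF_empty (w : ℝ≥0∞) (L : ℕ) : historyPGF w L ∅ = 1 :=
  historyPGF_of_admissible_eq_empty (by simp [admissible])

lemma succ_mul_historyPGF_Ico {w : ℝ≥0∞} {L a n : ℕ} (ha : 1 ≤ a) (hn : 1 ≤ n)
    (hL : a + n ≤ L + 1) :
    ((n + 1 : ℕ) : ℝ≥0∞) * historyPGF w L (Finset.Ico a (a + n))
      = w * ∑ j ∈ Finset.range (n + 1), historyPGF w L (Finset.Ico a (a + (j - 1))) *
        historyPGF w L (Finset.Ico (a + j + 1) (a + j + 1 + (n - 1 - j))) := by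
  have hfirst := card_mul_historyPGF w L (Finset.Ico a (a + n))
  rw [admissible_Ico ha hn hL, Nat.card_Ico, Nat.add_sub_cancel_left,
    Finset.sum_Ico_eq_sum_range, Nat.add_sub_cancel_left] at hfirst
  rw [hfirst]
  congr 1
  refine Finset.sum_congr rfl fun j hj => ?_
  rw [Ico_sdiff_dimer ha (Nat.lt_succ_iff.1 (Finset.mem_range.1 hj))]
  refine historyPGF_union (Finset.disjoint_left.2 fun k => ?_)
  simp only [mem_admissible, Finset.mem_Ico]
  omega

/-- The probability generating function of the number of dimers covering `n` consecutive sites. -/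
def intervalPGF (w : ℝ≥0∞) (n : ℕ) : ℝ≥0∞ := historyPGF w n (Finset.Ico 1 (1 + n))

lemma intervalPGF_zero (w : ℝ≥0∞) : intervalPGF w 0 = 1 := historyPGF_empty w 0

lemma intervalPGF_ne_top {w : ℝ≥0∞} (hw : w ≠ ∞) (n : ℕ) : intervalPGF w n ≠ ∞ :=
  historyPGF_ne_top hw _ _

lemma historyPGF_Ico (w : ℝ≥0∞) {L a n : ℕ} (ha : 1 ≤ a) (hL : n = 0 ∨ a + n ≤ L + 1) :
    historyPGF w L (Finset.Ico a (a + n)) = intervalPGF w n := by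
  induction n using Nat.strong_induction_on generalizing L a with
  | _ n ih =>
    rcases Nat.eq_zero_or_pos n with rfl | hn
    · rw [Nat.add_zero, Finset.Ico_self, historyPGF_empty, intervalPGF_zero]
    refine (ENNReal.mul_right_inj (a := ((n + 1 : ℕ) : ℝ≥0∞)) (by simp)
      (ENNReal.natCast_ne_top _)).1 ?_
    rw [intervalPGF, succ_mul_historyPGF_Ico ha hn (by omega),
      succ_mul_historyPGF_Ico le_rfl hn (by omega)]
    congr 1
    refine Finset.sum_congr rfl fun j hj => ?_
    rw [Finset.mem_range] at hj
    rw [ih (j - 1) (by omega) ha (by omega), ih (j - 1) (by omega) le_rfl (by omega),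
      ih (n - 1 - j) (by omega) (by omega) (by omega),
      ih (n - 1 - j) (by omega) (by omega) (by omega)]

-- The truncated differences vanish exactly when the first dimer overhangs an end of the interval.
lemma succ_mul_intervalPGF (w : ℝ≥0∞) {n : ℕ} (hn : 1 ≤ n) :
    ((n + 1 : ℕ) : ℝ≥0∞) * intervalPGF w n
      = w * ∑ j ∈ Finset.range (n + 1), intervalPGF w (j - 1) * intervalPGF w (n - 1 - j) := by
  rw [intervalPGF, succ_mul_historyPGF_Ico le_rfl hn (by omega)]
  congr 1
  refine Finset.sum_congr rfl fun j hj => ?_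
  rw [Finset.mem_range] at hj
  rw [historyPGF_Ico w le_rfl (by omega), historyPGF_Ico w (by omega) (by omega)]

instance (L : ℕ) : IsProbabilityMeasure (countLaw L) := by
  unfold countLaw
  infer_instance

lemma lintegral_exp_count (L : ℕ) (lam : ℝ) :
    ∫⁻ n, ENNReal.ofReal (Real.exp (lam * count n)) ∂(countLaw L)
      = intervalPGF (ENNReal.ofReal (Real.exp lam)) L := by
  simp_rw [lintegral_countable', countLaw,
    PMF.toMeasure_apply_singleton _ _ (measurableSet_singleton _), mul_comm _ (countPMF L _)]
  rw [countPMF, tsum_pmf_map_mul, intervalPGF, historyPGF, add_comm 1 L,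
    Finset.Ico_add_one_right_eq_Icc]
  refine tsum_congr fun l => ?_
  rw [count, mul_comm lam, Real.exp_nat_mul, ENNReal.ofReal_pow (Real.exp_pos _).le]

lemma integrable_exp_count (L : ℕ) (lam : ℝ) :
    Integrable (fun n => Real.exp (lam * count n)) (countLaw L) := by
  refine ⟨(measurable_of_countable _).aestronglyMeasurable, ?_⟩
  rw [hasFiniteIntegral_iff_ofReal (ae_of_all _ fun _ => (Real.exp_pos _).le),
    lintegral_exp_count]
  exact (intervalPGF_ne_top ENNReal.ofReal_ne_top _).lt_top

lemma F_eq_toReal_intervalPGF (lam : ℝ) (L : ℕ) :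
    F lam L = (intervalPGF (ENNReal.ofReal (Real.exp lam)) L).toReal := by
  rw [F, mgf, integral_eq_lintegral_of_nonneg_ae (ae_of_all _ fun _ => (Real.exp_pos _).le)
    (measurable_of_countable _).aestronglyMeasurable, lintegral_exp_count]

lemma F_pos (lam : ℝ) (L : ℕ) : 0 < F lam L := mgf_pos (integrable_exp_count L lam)

lemma F_zero (lam : ℝ) : F lam 0 = 1 := by
  rw [F_eq_toReal_intervalPGF, intervalPGF_zero, ENNReal.toReal_one]

lemma succ_mul_F (lam : ℝ) {n : ℕ} (hn : 1 ≤ n) :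
    ((n + 1 : ℕ) : ℝ) * F lam n
      = Real.exp lam * ∑ j ∈ Finset.range (n + 1), F lam (j - 1) * F lam (n - 1 - j) := by
  have hfin (m : ℕ) := intervalPGF_ne_top (w := ENNReal.ofReal (Real.exp lam))
    ENNReal.ofReal_ne_top m
  have h := congrArg ENNReal.toReal (succ_mul_intervalPGF (ENNReal.ofReal (Real.exp lam)) hn)
  rw [ENNReal.toReal_mul, ENNReal.toReal_mul, ENNReal.toReal_natCast,
    ENNReal.toReal_ofReal (Real.exp_pos _).le,
    ENNReal.toReal_sum fun j _ => ENNReal.mul_ne_top (hfin _) (hfin _)] at h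
  simpa only [ENNReal.toReal_mul, ← F_eq_toReal_intervalPGF] using h

/-- The Taylor coefficients at `0` of the solution of `Ψ' = z Ψ² + (1 - z)`, `Ψ(0) = 1`; the
inhomogeneity `1 - z` contributes to the coefficient of degree one only. -/
def riccatiCoeff (z : ℂ) : ℕ → ℂ
  | 0 => 1
  | n + 1 => (z * ∑ k : Fin (n + 1), riccatiCoeff z k * riccatiCoeff z (n - k) +
      if n = 0 then 1 - z else 0) / (n + 1)

lemma riccatiCoeff_zero (z : ℂ) : riccatiCoeff z 0 = 1 := by rw [riccatiCoeff]

lemma riccatiCoeff_succ (z : ℂ) (n : ℕ) :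
    riccatiCoeff z (n + 1) = (z * ∑ k ∈ Finset.range (n + 1),
      riccatiCoeff z k * riccatiCoeff z (n - k) + if n = 0 then 1 - z else 0) / (n + 1) := by
  rw [riccatiCoeff, Finset.sum_range]

-- With `n - 1 = 0` at `n = 0`, this also covers the constant coefficient `Ψ(0) = 1`.
lemma ofReal_F_sub_one (lam : ℝ) (n : ℕ) :
    (F lam (n - 1) : ℂ) = riccatiCoeff (Complex.exp lam) n := by
  induction n using Nat.strong_induction_on with
  | _ n ih =>
    rcases n with _ | n
    · rw [riccatiCoeff_zero, F_zero, Complex.ofReal_one]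
    rw [riccatiCoeff_succ, Nat.add_sub_cancel, eq_div_iff (Nat.cast_add_one_ne_zero n)]
    rcases Nat.eq_zero_or_pos n with rfl | hn
    · simp [F_zero, riccatiCoeff_zero]
    have hrec := congrArg Complex.ofReal (succ_mul_F lam hn)
    push_cast at hrec
    rw [if_neg hn.ne', add_zero, mul_comm, hrec]
    congr 1
    refine Finset.sum_congr rfl fun k hk => ?_
    have hk' := Finset.mem_range.1 hk
    rw [ih k hk', ← ih (n - k) (by omega), Nat.sub_right_comm]

end Combinatorics

section CotangentFunctions

open Complex

/-- The entire function `sin w / w`, with value `1` at `0`. -/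
def csinc : ℂ → ℂ := dslope sin 0

lemma mul_csinc (w : ℂ) : w * csinc w = sin w := by
  simpa only [sub_zero, smul_eq_mul, csinc] using sub_smul_dslope_of_zero sin_zero w

lemma csinc_zero : csinc 0 = 1 := by
  rw [csinc, dslope_same, (hasDerivAt_sin 0).deriv, cos_zero]

lemma differentiable_csinc : Differentiable ℂ csinc := by
  rw [← differentiableOn_univ, csinc, differentiableOn_dslope univ_mem]
  exact differentiable_sin.differentiableOn

lemma isOpen_csinc_ne_zero : IsOpen {w | csinc w ≠ 0} :=
  isOpen_ne_fun differentiable_csinc.continuous continuous_const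

lemma exists_int_of_csinc_eq_zero {w : ℂ} (hw : csinc w = 0) :
    ∃ n : ℤ, n ≠ 0 ∧ w = n * Real.pi := by
  obtain ⟨n, rfl⟩ := sin_eq_zero_iff.1 (by rw [← mul_csinc, hw, mul_zero])
  refine ⟨n, ?_, rfl⟩
  rintro rfl
  simp [csinc_zero] at hw

lemma csinc_ne_zero_of_norm_le_one {w : ℂ} (hw : ‖w‖ ≤ 1) : csinc w ≠ 0 := by
  intro hzero
  obtain ⟨n, hn, rfl⟩ := exists_int_of_csinc_eq_zero hzero
  rw [norm_mul, norm_intCast, norm_real, Real.norm_of_nonneg Real.pi_pos.le] at hw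
  have hn' : (1 : ℝ) ≤ |(n : ℝ)| := mod_cast Int.one_le_abs hn
  nlinarith [Real.pi_gt_three]

lemma mul_deriv_csinc (w : ℂ) : w * deriv csinc w = cos w - csinc w := by
  have hprod : HasDerivAt (fun u => u * csinc u) (1 * csinc w + w * deriv csinc w) w :=
    (hasDerivAt_id' w).fun_mul (differentiable_csinc w).hasDerivAt
  simp only [mul_csinc] at hprod
  linear_combination hprod.unique (hasDerivAt_sin w)

/-- The meromorphic function `w cot w`, with value `1` at `0`. -/
def mulCot (w : ℂ) : ℂ := cos w / csinc w

lemma mulCot_zero : mulCot 0 = 1 := by rw [mulCot, cos_zero, csinc_zero, div_one]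

lemma differentiableAt_mulCot {w : ℂ} (hw : csinc w ≠ 0) : DifferentiableAt ℂ mulCot w :=
  differentiableAt_cos.fun_div (differentiable_csinc w) hw

lemma mul_deriv_mulCot {w : ℂ} (hw : csinc w ≠ 0) :
    w * deriv mulCot w = mulCot w - w ^ 2 - mulCot w ^ 2 := by
  have hquot : HasDerivAt mulCot _ w :=
    (hasDerivAt_cos w).fun_div (differentiable_csinc w).hasDerivAt hw
  rw [hquot.deriv, mulCot, ← mul_csinc]
  field_simp
  linear_combination (-cos w) * mul_deriv_csinc w

/-- The function `cot w - 1 / w`, extended analytically to `0`. -/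
def cotRemainder : ℂ → ℂ := dslope mulCot 0

lemma mulCot_eq (w : ℂ) : mulCot w = 1 + w * cotRemainder w := by
  have h := sub_smul_dslope mulCot 0 w
  rw [sub_zero, smul_eq_mul, mulCot_zero] at h
  rw [cotRemainder, h, add_sub_cancel]

lemma differentiableAt_cotRemainder {w : ℂ} (hw : csinc w ≠ 0) :
    DifferentiableAt ℂ cotRemainder w := by
  have hnhds : {w | csinc w ≠ 0} ∈ 𝓝 (0 : ℂ) :=
    isOpen_csinc_ne_zero.mem_nhds (by simp [csinc_zero])
  exact ((differentiableOn_dslope hnhds).2 fun u hu =>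
    (differentiableAt_mulCot hu).differentiableWithinAt).differentiableAt
      (isOpen_csinc_ne_zero.mem_nhds hw)

end CotangentFunctions

section Riccati

open Complex
open scoped Nat

variable {z Λ y x : ℂ}

/-- The function `z⁻¹ Λ cot (Λ (y - x))` of `x`, which solves `Ψ' = z Ψ² + (1 - z)` when
`Λ² = z (1 - z)`. Written with `mulCot`, it makes sense for `Λ = 0` too. -/
def riccatiSol (z Λ y x : ℂ) : ℂ := mulCot (Λ * (y - x)) / (z * (y - x))

lemma hasDerivAt_riccatiSol (hz : z ≠ 0) (hΛ : Λ ^ 2 = z * (1 - z)) (hxy : x ≠ y)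
    (hx : csinc (Λ * (y - x)) ≠ 0) :
    HasDerivAt (riccatiSol z Λ y) (z * riccatiSol z Λ y x ^ 2 + (1 - z)) x := by
  have hyx : y - x ≠ 0 := sub_ne_zero.2 hxy.symm
  have hsub : HasDerivAt (fun x => y - x) (-1) x := (hasDerivAt_id' x).const_sub y
  have hquot := ((differentiableAt_mulCot hx).hasDerivAt.comp x (hsub.const_mul Λ)).fun_div
    (hsub.const_mul z) (mul_ne_zero hz hyx)
  refine hquot.congr_deriv ?_
  simp only [riccatiSol, Function.comp_apply]
  field_simp
  linear_combination (y - x) ^ 2 * hΛ - mul_deriv_mulCot hx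

lemma iteratedDeriv_of_riccati {f : ℂ → ℂ} (hf : AnalyticAt ℂ f 0) (hf0 : f 0 = 1)
    (hode : ∀ᶠ x in 𝓝 (0 : ℂ), deriv f x = z * f x ^ 2 + (1 - z)) (n : ℕ) :
    iteratedDeriv n f 0 = n ! * riccatiCoeff z n := by
  induction n using Nat.strong_induction_on with
  | _ n ih =>
    rcases n with _ | n
    · simp [hf0, riccatiCoeff_zero]
    have hode' : deriv f =ᶠ[𝓝 0] fun x => z * (f x * f x) + (1 - z) :=
      hode.mono fun x hx => by rw [hx, sq]
    have hsmooth : ContDiffAt ℂ n f 0 := hf.contDiffAt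
    have hleibniz : ∑ i ∈ Finset.range (n + 1), (n.choose i : ℂ) * iteratedDeriv i f 0
        * iteratedDeriv (n - i) f 0
        = n ! * ∑ k ∈ Finset.range (n + 1), riccatiCoeff z k * riccatiCoeff z (n - k) := by
      rw [Finset.mul_sum]
      refine Finset.sum_congr rfl fun i hi => ?_
      rw [Finset.mem_range] at hi
      rw [ih i hi, ih (n - i) (by omega),
        ← Nat.choose_mul_factorial_mul_factorial (Nat.lt_succ_iff.1 hi)]
      push_cast
      ring
    rw [iteratedDeriv_succ', hode'.iteratedDeriv_eq,
      iteratedDeriv_fun_add (contDiffAt_const.mul (hsmooth.mul hsmooth)) contDiffAt_const,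
      iteratedDeriv_const_mul_field, iteratedDeriv_fun_mul hsmooth hsmooth, iteratedDeriv_const,
      riccatiCoeff_succ, hleibniz, Nat.factorial_succ]
    have hn1 : (n : ℂ) + 1 ≠ 0 := Nat.cast_add_one_ne_zero n
    push_cast
    rcases Nat.eq_zero_or_pos n with rfl | hn
    · simp
    · simp only [hn.ne', if_false]
      field_simp
      ring

lemma meromorphicOrderAt_riccatiSol_sub_one (hz : z ≠ 0) (Λ y : ℂ) :
    meromorphicOrderAt (fun x => riccatiSol z Λ y x - 1) y = ((-1 : ℤ) : WithTop ℤ) := by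
  have hcot : AnalyticAt ℂ (fun x => mulCot (Λ * (y - x))) y := by
    have hne : ∀ᶠ x in 𝓝 y, csinc (Λ * (y - x)) ≠ 0 :=
      (isOpen_csinc_ne_zero.preimage (by fun_prop)).mem_nhds (by simp [csinc_zero])
    refine analyticAt_iff_eventually_differentiableAt.2 (hne.mono fun x hx => ?_)
    exact (differentiableAt_mulCot hx).fun_comp' x (by fun_prop)
  have hmero : MeromorphicAt (fun x => riccatiSol z Λ y x - 1) y :=
    (hcot.meromorphicAt.div (by fun_prop)).sub (by fun_prop)
  refine (meromorphicOrderAt_eq_int_iff hmero).2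
    ⟨fun x => -(mulCot (Λ * (y - x)) / z) - (x - y), ?_, ?_, ?_⟩
  · exact (hcot.div analyticAt_const hz).neg.sub (by fun_prop)
  · simp [mulCot_zero, hz]
  · filter_upwards [self_mem_nhdsWithin] with x hx
    have hxy : x - y ≠ 0 := sub_ne_zero.2 hx
    rw [riccatiSol, zpow_neg_one, smul_eq_mul, ← neg_sub x y]
    field_simp

/-- The part of `riccatiSol z Λ y` that stays regular at its pole `y`. -/
def riccatiRegularPart (z Λ y x : ℂ) : ℂ := z⁻¹ * Λ * cotRemainder (Λ * (y - x))

lemma riccatiSol_eq (hz : z ≠ 0) (hxy : x ≠ y) :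
    riccatiSol z Λ y x = z⁻¹ * (y - x)⁻¹ + riccatiRegularPart z Λ y x := by
  have hyx : y - x ≠ 0 := sub_ne_zero.2 hxy.symm
  rw [riccatiSol, riccatiRegularPart, mulCot_eq]
  field_simp

lemma differentiableAt_riccatiRegularPart (hx : csinc (Λ * (y - x)) ≠ 0) :
    DifferentiableAt ℂ (riccatiRegularPart z Λ y) x :=
  ((differentiableAt_cotRemainder hx).comp x (by fun_prop)).const_mul _

lemma iteratedDeriv_const_sub_inv (y : ℂ) (n : ℕ) :
    iteratedDeriv n (fun x => (y - x)⁻¹) 0 = n ! * (y ^ (n + 1))⁻¹ := by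
  have hlin : (fun x : ℂ => (y - x)⁻¹) = fun x => (-1 * x + y)⁻¹ := by
    ext x
    ring
  have hexp : (-1 - n : ℤ) = -((n + 1 : ℕ) : ℤ) := by
    push_cast
    ring
  rw [iteratedDeriv_eq_iterate, hlin, iter_deriv_inv_linear]
  simp only [mul_zero, zero_add, hexp, zpow_neg, zpow_natCast]
  rw [mul_right_comm ((-1 : ℂ) ^ n), ← mul_pow, neg_one_mul, neg_neg, one_pow, one_mul]

/-- The parameters for which `riccatiSol z Λ y` solves `Ψ' = z Ψ² + (1 - z)` with `Ψ(0) = 1`; its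
pole is then `y`. -/
structure IsRiccatiPole (z Λ y : ℂ) : Prop where
  z_ne_zero : z ≠ 0
  y_ne_zero : y ≠ 0
  sq_eq : Λ ^ 2 = z * (1 - z)
  csinc_ne_zero : csinc (Λ * y) ≠ 0
  mulCot_eq : mulCot (Λ * y) = z * y

namespace IsRiccatiPole

lemma riccatiSol_zero (H : IsRiccatiPole z Λ y) : riccatiSol z Λ y 0 = 1 := by
  rw [riccatiSol, sub_zero, H.mulCot_eq, div_self (mul_ne_zero H.z_ne_zero H.y_ne_zero)]

lemma iteratedDeriv_riccatiSol (H : IsRiccatiPole z Λ y) (n : ℕ) :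
    iteratedDeriv n (riccatiSol z Λ y) 0 = n ! * riccatiCoeff z n := by
  have hcsinc : ∀ᶠ x in 𝓝 (0 : ℂ), csinc (Λ * (y - x)) ≠ 0 :=
    (isOpen_csinc_ne_zero.preimage (by fun_prop)).mem_nhds (by simpa using H.csinc_ne_zero)
  have hderiv : ∀ᶠ x in 𝓝 (0 : ℂ),
      HasDerivAt (riccatiSol z Λ y) (z * riccatiSol z Λ y x ^ 2 + (1 - z)) x := by
    filter_upwards [hcsinc, eventually_ne_nhds H.y_ne_zero.symm] with x hx hxy
    exact hasDerivAt_riccatiSol H.z_ne_zero H.sq_eq hxy hx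
  exact iteratedDeriv_of_riccati
    (analyticAt_iff_eventually_differentiableAt.2 (hderiv.mono fun x hx => hx.differentiableAt))
    H.riccatiSol_zero (hderiv.mono fun x hx => hx.deriv) n

lemma hasSum_riccatiCoeff (H : IsRiccatiPole z Λ y) {r : ℝ} (hr : r ≤ ‖y‖)
    (hcsinc : ∀ x, ‖x‖ < r → csinc (Λ * (y - x)) ≠ 0) (hx : ‖x‖ < r) :
    HasSum (fun n => riccatiCoeff z n * x ^ n) (riccatiSol z Λ y x) := by
  have hdiff : DifferentiableOn ℂ (riccatiSol z Λ y) (Metric.ball 0 r) := by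
    intro u hu
    rw [mem_ball_zero_iff] at hu
    refine (hasDerivAt_riccatiSol H.z_ne_zero H.sq_eq ?_
      (hcsinc u hu)).differentiableAt.differentiableWithinAt
    rintro rfl
    exact hu.not_ge hr
  refine (hasSum_taylorSeries_on_ball hdiff (mem_ball_zero_iff.2 hx)).congr_fun fun n => ?_
  have hn : (n ! : ℂ) ≠ 0 := Nat.cast_ne_zero.2 n.factorial_ne_zero
  rw [H.iteratedDeriv_riccatiSol, sub_zero, smul_eq_mul, smul_eq_mul]
  field_simp

lemma iteratedDeriv_riccatiRegularPart (H : IsRiccatiPole z Λ y) (n : ℕ) :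
    iteratedDeriv n (riccatiRegularPart z Λ y) 0
      = n ! * (riccatiCoeff z n - z⁻¹ * (y ^ (n + 1))⁻¹) := by
  have hreg : AnalyticAt ℂ (riccatiRegularPart z Λ y) 0 := by
    have hcsinc : ∀ᶠ x in 𝓝 (0 : ℂ), csinc (Λ * (y - x)) ≠ 0 :=
      (isOpen_csinc_ne_zero.preimage (by fun_prop)).mem_nhds (by simpa using H.csinc_ne_zero)
    exact analyticAt_iff_eventually_differentiableAt.2 <|
      hcsinc.mono fun x hx => differentiableAt_riccatiRegularPart hx
  have hpole : AnalyticAt ℂ (fun x => z⁻¹ * (y - x)⁻¹) 0 :=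
    analyticAt_const.mul ((analyticAt_const.sub analyticAt_id).inv (by simpa using H.y_ne_zero))
  have hsplit : riccatiSol z Λ y =ᶠ[𝓝 0] fun x => z⁻¹ * (y - x)⁻¹ + riccatiRegularPart z Λ y x :=
    (eventually_ne_nhds H.y_ne_zero.symm).mono fun x hx => riccatiSol_eq H.z_ne_zero hx
  have hsum := H.iteratedDeriv_riccatiSol n
  rw [hsplit.iteratedDeriv_eq, iteratedDeriv_fun_add hpole.contDiffAt hreg.contDiffAt,
    iteratedDeriv_const_mul_field, iteratedDeriv_const_sub_inv] at hsum
  linear_combination hsum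

lemma norm_riccatiCoeff_sub_le (H : IsRiccatiPole z Λ y) {ρ C : ℝ} (hρ : 0 < ρ)
    (hcsinc : ∀ x, ‖x‖ ≤ ρ → csinc (Λ * (y - x)) ≠ 0)
    (hC : ∀ x, ‖x‖ = ρ → ‖riccatiRegularPart z Λ y x‖ ≤ C) (n : ℕ) :
    ‖riccatiCoeff z n - z⁻¹ * (y ^ (n + 1))⁻¹‖ ≤ C / ρ ^ n := by
  have hdiff : DiffContOnCl ℂ (riccatiRegularPart z Λ y) (Metric.ball 0 ρ) := by
    refine DifferentiableOn.diffContOnCl fun x hx =>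
      (differentiableAt_riccatiRegularPart (hcsinc x ?_)).differentiableWithinAt
    rwa [closure_ball _ hρ.ne', mem_closedBall_zero_iff] at hx
  have hcauchy := norm_iteratedDeriv_le_of_forall_mem_sphere_norm_le n hρ hdiff (C := C)
    fun x hx => hC x (mem_sphere_zero_iff_norm.1 hx)
  rw [H.iteratedDeriv_riccatiRegularPart, norm_mul, norm_natCast, mul_div_assoc] at hcauchy
  exact le_of_mul_le_mul_left hcauchy (Nat.cast_pos.2 n.factorial_pos)

lemma norm_scaled_riccatiCoeff_sub_one_le (H : IsRiccatiPole z Λ y) {ρ C : ℝ} (hρ : 0 < ρ)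
    (hcsinc : ∀ x, ‖x‖ ≤ ρ → csinc (Λ * (y - x)) ≠ 0)
    (hC : ∀ x, ‖x‖ = ρ → ‖riccatiRegularPart z Λ y x‖ ≤ C) (n : ℕ) :
    ‖z * y ^ (n + 1) * riccatiCoeff z n - 1‖ ≤ ‖z‖ * ‖y‖ * C * (‖y‖ / ρ) ^ n := by
  have hz := H.z_ne_zero
  have hy := H.y_ne_zero
  calc ‖z * y ^ (n + 1) * riccatiCoeff z n - 1‖
      = ‖z‖ * ‖y‖ ^ (n + 1) * ‖riccatiCoeff z n - z⁻¹ * (y ^ (n + 1))⁻¹‖ := by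
        rw [← norm_pow, ← norm_mul, ← norm_mul]
        congr 1
        field_simp
    _ ≤ ‖z‖ * ‖y‖ ^ (n + 1) * (C / ρ ^ n) := by
        gcongr
        exact H.norm_riccatiCoeff_sub_le hρ hcsinc hC n
    _ = ‖z‖ * ‖y‖ * C * (‖y‖ / ρ) ^ n := by
        rw [div_pow]
        ring

lemma tendsto_scaled_riccatiCoeff (H : IsRiccatiPole z Λ y)
    (hcsinc : ∀ x, ‖x‖ ≤ ‖y‖ → csinc (Λ * (y - x)) ≠ 0) :
    Tendsto (fun n : ℕ => z * y ^ (n + 1) * riccatiCoeff z n) atTop (𝓝 1) := by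
  obtain ⟨ρ, hyρ, hρ⟩ : ∃ ρ > ‖y‖, ∀ x, ‖x‖ ≤ ρ → csinc (Λ * (y - x)) ≠ 0 := by
    obtain ⟨δ, hδ, hsub⟩ := (isCompact_closedBall (0 : ℂ) ‖y‖).exists_cthickening_subset_open
      (isOpen_csinc_ne_zero.preimage (by fun_prop : Continuous fun x => Λ * (y - x)))
      fun x hx => hcsinc x (mem_closedBall_zero_iff.1 hx)
    rw [cthickening_closedBall hδ.le (norm_nonneg y)] at hsub
    exact ⟨δ + ‖y‖, lt_add_of_pos_left _ hδ, fun x hx => hsub (mem_closedBall_zero_iff.2 hx)⟩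
  have hρ_pos : 0 < ρ := (norm_nonneg y).trans_lt hyρ
  obtain ⟨C, hC⟩ := (isCompact_closedBall (0 : ℂ) ρ).exists_bound_of_continuousOn
    (f := riccatiRegularPart z Λ y) fun x hx =>
      (differentiableAt_riccatiRegularPart
        (hρ x (mem_closedBall_zero_iff.1 hx))).continuousAt.continuousWithinAt
  have hgeom : Tendsto (fun n : ℕ => ‖z‖ * ‖y‖ * C * (‖y‖ / ρ) ^ n) atTop (𝓝 0) := by
    simpa only [mul_zero] using (tendsto_pow_atTop_nhds_zero_of_lt_one (by positivity)
      ((div_lt_one hρ_pos).2 hyρ)).const_mul (‖z‖ * ‖y‖ * C)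
  exact tendsto_sub_nhds_zero_iff.1 <| squeeze_zero_norm
    (H.norm_scaled_riccatiCoeff_sub_one_le hρ_pos hρ fun x hx =>
      hC x (mem_closedBall_zero_iff.2 hx.le)) hgeom

lemma mul_cos_eq (H : IsRiccatiPole z Λ y) : Λ * cos (Λ * y) = z * sin (Λ * y) := by
  have h := H.mulCot_eq
  rw [mulCot, div_eq_iff H.csinc_ne_zero] at h
  rw [h, ← mul_csinc]
  ring

/-- The addition formulas turn the cotangent `riccatiSol` into the tangent of the closed form. -/
lemma tan_div_eq (H : IsRiccatiPole z Λ y) (hΛ : Λ ≠ 0) (hxy : x ≠ y) (hcos : cos (Λ * x) ≠ 0)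
    (hx : csinc (Λ * (y - x)) ≠ 0) :
    Λ - z * tan (Λ * x) ≠ 0 ∧
      tan (Λ * x) / (Λ - z * tan (Λ * x)) = riccatiSol z Λ y x - 1 := by
  have hz := H.z_ne_zero
  have hyx : y - x ≠ 0 := sub_ne_zero.2 hxy.symm
  have hsin_y : sin (Λ * y) ≠ 0 := by
    rw [← mul_csinc]
    exact mul_ne_zero (mul_ne_zero hΛ H.y_ne_zero) H.csinc_ne_zero
  have hsin_sub : Λ * sin (Λ * (y - x))
      = sin (Λ * y) * (Λ * cos (Λ * x) - z * sin (Λ * x)) := by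
    rw [mul_sub Λ, sin_sub]
    linear_combination (-sin (Λ * x)) * H.mul_cos_eq
  have hcos_sub : Λ * cos (Λ * (y - x))
      = sin (Λ * y) * (z * cos (Λ * x) + Λ * sin (Λ * x)) := by
    rw [mul_sub Λ, cos_sub]
    linear_combination cos (Λ * x) * H.mul_cos_eq
  have hden : Λ * cos (Λ * x) - z * sin (Λ * x) ≠ 0 := by
    refine right_ne_zero_of_mul (a := sin (Λ * y)) ?_
    rw [← hsin_sub, ← mul_csinc]
    exact mul_ne_zero hΛ (mul_ne_zero (mul_ne_zero hΛ hyx) hx)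
  have hsol : riccatiSol z Λ y x
      = Λ * (z * cos (Λ * x) + Λ * sin (Λ * x))
        / (z * (Λ * cos (Λ * x) - z * sin (Λ * x))) := by
    rw [← mul_div_mul_left _ (z * _) hsin_y, mul_left_comm _ Λ, mul_left_comm _ z, ← hcos_sub,
      ← hsin_sub, ← mul_csinc, riccatiSol, mulCot]
    field_simp
  rw [hsol, tan_eq_sin_div_cos, mul_div_assoc', sub_div' hcos, div_div_div_cancel_right₀ hcos]
  refine ⟨div_ne_zero hden hcos, ?_⟩
  rw [div_sub_one (mul_ne_zero hz hden), div_eq_div_iff hden (mul_ne_zero hz hden)]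
  linear_combination (-sin (Λ * x) * (Λ * cos (Λ * x) - z * sin (Λ * x))) * H.sq_eq

end IsRiccatiPole

end Riccati

section Arctan

open Complex

lemma exists_pos_eq_mul_of_strictMonoOn {f : ℝ → ℝ} {s : Set ℝ} (hf : StrictMonoOn f s)
    (hs : 0 ∈ s) (hf0 : f 0 = 0) {t : ℝ} (ht : t ∈ s) : ∃ p > 0, f t = p * t := by
  rcases lt_trichotomy t 0 with hneg | rfl | hpos
  · exact ⟨f t / t, div_pos_of_neg_of_neg (hf0 ▸ hf ht hs hneg) hneg,
      (div_mul_cancel₀ _ hneg.ne).symm⟩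
  · exact ⟨1, one_pos, by rw [hf0, mul_zero]⟩
  · exact ⟨f t / t, div_pos (hf0 ▸ hf hs ht hpos) hpos, (div_mul_cancel₀ _ hpos.ne').symm⟩

lemma arctan_ofReal_mul_I {t : ℝ} (ht : t ∈ Set.Ioo (-1) 1) :
    arctan (t * I) = Real.artanh t * I := by
  have htan : tan (Real.artanh t * I) = t * I := by
    rw [tan_mul_I, ← ofReal_tanh, Real.tanh_artanh ht]
  have hre : (Real.artanh t * I).re = 0 := by simp
  rw [← htan]
  refine arctan_tan (fun h => ?_) ?_ ?_
  · rw [h] at hre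
    exact Real.pi_div_two_pos.ne' (mod_cast hre)
  · rw [hre]
    exact neg_lt_zero.2 Real.pi_div_two_pos
  · rw [hre]
    exact Real.pi_div_two_pos.le

lemma exists_pos_arctan_eq_mul {t : ℂ} {s : ℝ} (hs : -1 < s) (ht : t ^ 2 = s) :
    ∃ p : ℝ, 0 < p ∧ arctan t = p * t ∧ |(arctan t).re| < Real.pi / 2 := by
  rcases le_or_gt 0 s with hs0 | hs0
  · obtain ⟨τ, rfl⟩ : ∃ τ : ℝ, t = τ := by
      have hsq : t ^ 2 = (√s : ℂ) ^ 2 := by rw [ht, ← ofReal_pow, Real.sq_sqrt hs0]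
      rcases sq_eq_sq_iff_eq_or_eq_neg.1 hsq with h | h
      · exact ⟨√s, h⟩
      · exact ⟨-√s, by rw [h, ofReal_neg]⟩
    obtain ⟨p, hp, hpτ⟩ := exists_pos_eq_mul_of_strictMonoOn
      (Real.arctan_strictMono.strictMonoOn Set.univ) trivial Real.arctan_zero (Set.mem_univ τ)
    refine ⟨p, hp, by rw [← ofReal_arctan, hpτ, ofReal_mul], ?_⟩
    rw [← ofReal_arctan, ofReal_re, abs_lt]
    exact ⟨Real.neg_pi_div_two_lt_arctan τ, Real.arctan_lt_pi_div_two τ⟩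
  · obtain ⟨τ, rfl⟩ : ∃ τ : ℝ, t = τ * I := by
      have hsq : t ^ 2 = (√(-s) * I : ℂ) ^ 2 := by
        rw [ht, mul_pow, I_sq, ← ofReal_pow, Real.sq_sqrt (by linarith), ofReal_neg, mul_neg_one,
          neg_neg]
      rcases sq_eq_sq_iff_eq_or_eq_neg.1 hsq with h | h
      · exact ⟨√(-s), h⟩
      · exact ⟨-√(-s), by rw [h, ofReal_neg, neg_mul]⟩
    have hτ : τ ∈ Set.Ioo (-1) 1 := by
      rw [mul_pow, I_sq, mul_neg_one, ← ofReal_pow, ← ofReal_neg, ofReal_inj] at ht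
      exact abs_lt.1 ((sq_lt_one_iff_abs_lt_one τ).1 (by linarith))
    obtain ⟨p, hp, hpτ⟩ := exists_pos_eq_mul_of_strictMonoOn Real.strictMonoOn_artanh
      (by norm_num) Real.artanh_zero hτ
    refine ⟨p, hp, by rw [arctan_ofReal_mul_I hτ, hpτ, ofReal_mul, mul_assoc], ?_⟩
    rw [arctan_ofReal_mul_I hτ, re_ofReal_mul, I_re, mul_zero, abs_zero]
    exact Real.pi_div_two_pos

lemma isRiccatiPole_arctan {z t : ℂ} (hz : z * (1 + t ^ 2) = 1) (ht : t ≠ 0) :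
    IsRiccatiPole z (z * t) (arctan t / (z * t)) := by
  have hz0 : z ≠ 0 := left_ne_zero_of_mul_eq_one hz
  have htan : tan (arctan t) = t := by
    refine tan_arctan ?_ ?_ <;> rintro rfl <;> simp at hz
  obtain ⟨hsin, hcos⟩ : sin (arctan t) ≠ 0 ∧ cos (arctan t) ≠ 0 := by
    rwa [← div_ne_zero_iff, ← tan_eq_sin_div_cos, htan]
  obtain ⟨harctan, hcsinc⟩ : arctan t ≠ 0 ∧ csinc (arctan t) ≠ 0 := by
    rwa [← mul_ne_zero_iff, mul_csinc]
  have hcancel : z * t * (arctan t / (z * t)) = arctan t := mul_div_cancel₀ _ (mul_ne_zero hz0 ht)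
  refine ⟨hz0, div_ne_zero harctan (mul_ne_zero hz0 ht), ?_, by rwa [hcancel], ?_⟩
  · linear_combination z * hz
  · rw [tan_eq_sin_div_cos, div_eq_iff hcos, ← mul_csinc] at htan
    rw [hcancel, mulCot, mul_div_assoc', mul_div_mul_left _ _ hz0, div_eq_div_iff hcsinc ht,
      htan, mul_comm]

end Arctan

section RealParameter

open Complex

variable {lam : ℝ} {x : ℂ}

/-- The argument `e^{-λ/2} √(1 - e^λ)` of the arctangent in the definition of `y`. -/
def arctanArg (lam : ℝ) : ℂ := exp (-lam / 2) * root lam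

lemma exp_mul_arctanArg (lam : ℝ) : exp lam * arctanArg lam = Lam lam := by
  rw [arctanArg, Lam, ← mul_assoc, ← exp_add]
  congr 2
  ring

lemma arctanArg_sq (lam : ℝ) : arctanArg lam ^ 2 = (Real.exp (-lam) - 1 : ℝ) := by
  have hroot : root lam ^ 2 = 1 - exp lam := by
    rw [root, ← cpow_nat_mul]
    norm_num
  have hexp : exp (-lam / 2) ^ 2 = exp (-lam) := by
    rw [← exp_nat_mul]
    push_cast
    rw [mul_div_cancel₀ _ two_ne_zero]
  rw [arctanArg, mul_pow, hroot, hexp, mul_sub, mul_one, ← exp_add, neg_add_cancel, exp_zero]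
  push_cast
  rfl

lemma exp_mul_one_add_arctanArg_sq (lam : ℝ) : exp lam * (1 + arctanArg lam ^ 2) = 1 := by
  rw [arctanArg_sq, ofReal_sub, ofReal_one, add_sub_cancel, ofReal_exp, ofReal_neg, ← exp_add,
    add_neg_cancel, exp_zero]

lemma arctanArg_ne_zero (hlam : lam ≠ 0) : arctanArg lam ≠ 0 := by
  rwa [← pow_ne_zero_iff two_ne_zero, arctanArg_sq, ofReal_ne_zero, sub_ne_zero, ne_eq,
    Real.exp_eq_one_iff, neg_eq_zero]

lemma Lam_ne_zero (hlam : lam ≠ 0) : Lam lam ≠ 0 := by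
  rw [← exp_mul_arctanArg]
  exact mul_ne_zero (exp_ne_zero _) (arctanArg_ne_zero hlam)

lemma Lam_zero : Lam 0 = 0 := by
  rw [← exp_mul_arctanArg, sq_eq_zero_iff.1 (by simp [arctanArg_sq] : arctanArg 0 ^ 2 = 0),
    mul_zero]

lemma y_zero : y 0 = 1 := by rw [y, if_pos rfl]

lemma exists_pos_arctan_div_Lam_eq (hlam : lam ≠ 0) :
    ∃ q : ℝ, 0 < q ∧ arctan (arctanArg lam) / Lam lam = q := by
  obtain ⟨p, hp, hmul, -⟩ := exists_pos_arctan_eq_mul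
    (by linarith [Real.exp_pos (-lam)]) (arctanArg_sq lam)
  refine ⟨p / Real.exp lam, div_pos hp (Real.exp_pos _), ?_⟩
  rw [hmul, ← exp_mul_arctanArg, mul_div_mul_right _ _ (arctanArg_ne_zero hlam), ofReal_div,
    ofReal_exp]

lemma ofReal_y (hlam : lam ≠ 0) : (y lam : ℂ) = arctan (arctanArg lam) / Lam lam := by
  obtain ⟨q, -, hq⟩ := exists_pos_arctan_div_Lam_eq hlam
  rw [y, if_neg hlam, ← arctanArg, hq, ofReal_re]

lemma y_pos (lam : ℝ) : 0 < y lam := by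
  rcases eq_or_ne lam 0 with rfl | hlam
  · exact y_zero ▸ one_pos
  · obtain ⟨q, hq_pos, hq⟩ := exists_pos_arctan_div_Lam_eq hlam
    rwa [y, if_neg hlam, ← arctanArg, hq, ofReal_re]

lemma norm_ofReal_y (lam : ℝ) : ‖(y lam : ℂ)‖ = y lam := by
  rw [norm_real, Real.norm_of_nonneg (y_pos lam).le]

lemma ne_y_of_norm_lt (hx : ‖x‖ < y lam) : x ≠ y lam := by
  rintro rfl
  exact hx.ne (norm_ofReal_y lam)

lemma isRiccatiPole_one : IsRiccatiPole 1 0 1 := by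
  constructor <;> simp [csinc_zero, mulCot_zero]

lemma isRiccatiPole_y (lam : ℝ) : IsRiccatiPole (exp lam) (Lam lam) (y lam) := by
  rcases eq_or_ne lam 0 with rfl | hlam
  · simpa only [Lam_zero, y_zero, ofReal_zero, ofReal_one, exp_zero] using isRiccatiPole_one
  · rw [ofReal_y hlam, ← exp_mul_arctanArg]
    exact isRiccatiPole_arctan (exp_mul_one_add_arctanArg_sq lam) (arctanArg_ne_zero hlam)

lemma abs_re_Lam_mul_y_lt (lam : ℝ) : |(Lam lam * y lam).re| < Real.pi / 2 := by
  rcases eq_or_ne lam 0 with rfl | hlam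
  · rw [Lam_zero, zero_mul, zero_re, abs_zero]
    exact Real.pi_div_two_pos
  · obtain ⟨-, -, -, hre⟩ := exists_pos_arctan_eq_mul
      (by linarith [Real.exp_pos (-lam)]) (arctanArg_sq lam)
    rwa [ofReal_y hlam, mul_div_cancel₀ _ (Lam_ne_zero hlam)]

lemma norm_lt_norm_sub_int_mul_pi {θ : ℂ} (hθ : |θ.re| < Real.pi / 2) {n : ℤ} (hn : n ≠ 0) :
    ‖θ‖ < ‖θ - n * Real.pi‖ := by
  have hre : |θ.re| < |θ.re - n * Real.pi| := by
    have hpi : Real.pi ≤ |n * Real.pi| := by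
      rw [abs_mul, abs_of_pos Real.pi_pos]
      exact le_mul_of_one_le_left Real.pi_pos.le (mod_cast Int.one_le_abs hn)
    have htri := abs_sub_abs_le_abs_sub (n * Real.pi) θ.re
    rw [abs_sub_comm] at htri
    linarith
  rw [← sq_lt_sq₀ (norm_nonneg _) (norm_nonneg _), Complex.sq_norm, Complex.sq_norm,
    normSq_apply, normSq_apply]
  have hre_sub : (θ - n * Real.pi).re = θ.re - n * Real.pi := by simp
  have him_sub : (θ - n * Real.pi).im = θ.im := by simp
  rw [hre_sub, him_sub]
  linarith [sq_lt_sq.2 hre, sq θ.re, sq (θ.re - n * Real.pi)]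

/-- Among the poles `y - nπ/Λ` of `riccatiSol`, the one with `n = 0` has the smallest modulus. -/
lemma csinc_ne_zero_of_norm_le {Λ y x : ℂ} (hre : |(Λ * y).re| < Real.pi / 2)
    (hx : ‖x‖ ≤ ‖y‖) : csinc (Λ * (y - x)) ≠ 0 := by
  intro hzero
  obtain ⟨n, hn, hpi⟩ := exists_int_of_csinc_eq_zero hzero
  have hlt := norm_lt_norm_sub_int_mul_pi hre hn
  rw [← hpi, mul_sub, sub_sub_cancel, norm_mul, norm_mul] at hlt
  exact hlt.not_ge (mul_le_mul_of_nonneg_left hx (norm_nonneg Λ))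

lemma csinc_Lam_mul_ne_zero (hx : ‖x‖ ≤ ‖(y lam : ℂ)‖) : csinc (Lam lam * (y lam - x)) ≠ 0 :=
  csinc_ne_zero_of_norm_le (abs_re_Lam_mul_y_lt lam) hx

lemma hasSum_F (hx : ‖x‖ < y lam) :
    HasSum (fun L : ℕ => (F lam L : ℂ) * x ^ (L + 1))
      (riccatiSol (exp lam) (Lam lam) (y lam) x - 1) := by
  have hsum := (isRiccatiPole_y lam).hasSum_riccatiCoeff le_rfl
    (fun u hu => csinc_Lam_mul_ne_zero hu.le) (hx.trans_eq (norm_ofReal_y lam).symm)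
  rw [← hasSum_nat_add_iff' 1] at hsum
  simp only [Finset.range_one, Finset.sum_singleton, riccatiCoeff_zero, pow_zero, mul_one] at hsum
  refine hsum.congr_fun fun L => ?_
  rw [← ofReal_F_sub_one, Nat.add_sub_cancel]

lemma hasSum_closedForm (hlam : lam ≠ 0) (hx : ‖x‖ < y lam) (hcos : cos (Lam lam * x) ≠ 0) :
    Lam lam - exp lam * tan (Lam lam * x) ≠ 0 ∧
      HasSum (fun L : ℕ => (F lam L : ℂ) * x ^ (L + 1)) (closedForm lam x) := by
  obtain ⟨hden, hclosed⟩ := (isRiccatiPole_y lam).tan_div_eq (Lam_ne_zero hlam)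
    (ne_y_of_norm_lt hx) hcos (csinc_Lam_mul_ne_zero (hx.le.trans_eq (norm_ofReal_y lam).symm))
  exact ⟨hden, by rw [closedForm, hclosed]; exact hasSum_F hx⟩

lemma riccatiSol_one_zero_one_sub_one (hx : x ≠ 1) : riccatiSol 1 0 1 x - 1 = x / (1 - x) := by
  have hx' : 1 - x ≠ 0 := sub_ne_zero.2 hx.symm
  rw [riccatiSol, zero_mul, mulCot_zero, one_mul, div_sub_one hx', sub_sub_cancel]

lemma hasSum_F_zero (hx : ‖x‖ < y 0) :
    HasSum (fun L : ℕ => (F 0 L : ℂ) * x ^ (L + 1)) (x / (1 - x)) := by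
  have hx1 : x ≠ 1 := by simpa [y_zero] using ne_y_of_norm_lt hx
  simpa [Lam_zero, y_zero, riccatiSol_one_zero_one_sub_one hx1] using hasSum_F hx

lemma meromorphicOrderAt_closedForm (hlam : lam ≠ 0) :
    meromorphicOrderAt (closedForm lam) (y lam : ℂ) = ((-1 : ℤ) : WithTop ℤ) := by
  have H := isRiccatiPole_y lam
  have hcsinc : ∀ᶠ x in 𝓝 (y lam : ℂ), csinc (Lam lam * (y lam - x)) ≠ 0 :=
    (isOpen_csinc_ne_zero.preimage (by fun_prop)).mem_nhds (by simp [csinc_zero])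
  have hcos_y : cos (Lam lam * y lam) ≠ 0 := by
    have hcot : mulCot (Lam lam * y lam) ≠ 0 :=
      H.mulCot_eq ▸ mul_ne_zero H.z_ne_zero H.y_ne_zero
    exact (div_ne_zero_iff.1 hcot).1
  have hcos : ∀ᶠ x in 𝓝 (y lam : ℂ), cos (Lam lam * x) ≠ 0 :=
    ContinuousAt.eventually_ne (by fun_prop) hcos_y
  rw [← meromorphicOrderAt_riccatiSol_sub_one H.z_ne_zero (Lam lam) (y lam)]
  refine meromorphicOrderAt_congr ?_
  filter_upwards [self_mem_nhdsWithin, nhdsWithin_le_nhds hcsinc, nhdsWithin_le_nhds hcos]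
    with x hxy hx hcosx
  exact (H.tan_div_eq (Lam_ne_zero hlam) hxy hcosx hx).2

lemma meromorphicOrderAt_div_one_sub :
    meromorphicOrderAt (fun x : ℂ => x / (1 - x)) (y 0 : ℂ) = ((-1 : ℤ) : WithTop ℤ) := by
  rw [y_zero, ofReal_one, ← meromorphicOrderAt_riccatiSol_sub_one one_ne_zero 0 1]
  refine meromorphicOrderAt_congr ?_
  filter_upwards [self_mem_nhdsWithin] with x hx
  exact (riccatiSol_one_zero_one_sub_one hx).symm

lemma tan_mul_div_eq_csinc {Λ : ℂ} (hΛ : Λ ≠ 0) (z : ℂ) (hcos : cos (Λ * x) ≠ 0) :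
    tan (Λ * x) / (Λ - z * tan (Λ * x))
      = x * csinc (Λ * x) / (cos (Λ * x) - z * (x * csinc (Λ * x))) := by
  rw [tan_eq_sin_div_cos, ← mul_csinc, mul_div_assoc', sub_div' hcos,
    div_div_div_cancel_right₀ hcos, ← mul_div_mul_left (x * _) _ hΛ]
  ring

lemma tendsto_Lam : Tendsto Lam (𝓝 0) (𝓝 0) := by
  have hsqrt : (fun lam : ℝ => ‖Lam lam‖) = fun lam : ℝ => √‖exp lam * (1 - exp lam)‖ := by
    ext lam
    rw [← (isRiccatiPole_y lam).sq_eq, norm_pow, Real.sqrt_sq (norm_nonneg _)]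
  have hcont : Continuous fun lam : ℝ => √‖exp lam * (1 - exp lam)‖ := by fun_prop
  rw [tendsto_zero_iff_norm_tendsto_zero, hsqrt]
  simpa using hcont.tendsto 0

lemma tendsto_closedForm (hx : ‖x‖ < 1) :
    Tendsto (fun lam : ℝ => closedForm lam x) (𝓝[≠] 0) (𝓝 (x / (1 - x))) := by
  have hx1 : 1 - x ≠ 0 := sub_ne_zero.2 (by rintro rfl; simp at hx)
  have hLam : Tendsto (fun lam => Lam lam * x) (𝓝 0) (𝓝 0) := by
    simpa only [zero_mul] using tendsto_Lam.mul_const x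
  have hcos : Tendsto (fun lam => cos (Lam lam * x)) (𝓝 0) (𝓝 1) := by
    simpa only [cos_zero, Function.comp_def] using (continuous_cos.tendsto 0).comp hLam
  have hcsinc : Tendsto (fun lam => x * csinc (Lam lam * x)) (𝓝 0) (𝓝 x) := by
    simpa only [csinc_zero, mul_one, Function.comp_def]
      using ((differentiable_csinc.continuous.tendsto 0).comp hLam).const_mul x
  have hexp : Tendsto (fun lam : ℝ => exp lam) (𝓝 0) (𝓝 1) := by
    have hcont : Continuous fun lam : ℝ => exp lam := by fun_prop
    simpa using hcont.tendsto 0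
  have hlim := hcsinc.div (hcos.sub (hexp.mul hcsinc)) (by rwa [one_mul])
  rw [one_mul] at hlim
  refine (hlim.mono_left nhdsWithin_le_nhds).congr' ?_
  filter_upwards [self_mem_nhdsWithin, nhdsWithin_le_nhds (hcos.eventually_ne one_ne_zero)]
    with lam hlam hcosx
  exact (tan_mul_div_eq_csinc (Lam_ne_zero hlam) _ hcosx).symm

lemma tendsto_scaled_F (lam : ℝ) :
    Tendsto (fun L : ℕ => Real.exp lam * y lam ^ (L + 2) * F lam L) atTop (𝓝 1) := by
  have hscaled := ((isRiccatiPole_y lam).tendsto_scaled_riccatiCoeff fun x hx =>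
    csinc_Lam_mul_ne_zero hx).comp (tendsto_add_atTop_nat 1)
  rw [← tendsto_ofReal_iff]
  refine hscaled.congr fun L => ?_
  rw [Function.comp_apply, ← ofReal_F_sub_one, Nat.add_sub_cancel]
  push_cast
  rfl

lemma log_F (lam : ℝ) (L : ℕ) : Real.log (F lam L)
    = Real.log (Real.exp lam * y lam ^ (L + 2) * F lam L) - lam - (L + 2) * Real.log (y lam) := by
  have hpow : y lam ^ (L + 2) ≠ 0 := pow_ne_zero _ (y_pos lam).ne'
  rw [Real.log_mul (mul_ne_zero (Real.exp_ne_zero _) hpow) (F_pos lam L).ne',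
    Real.log_mul (Real.exp_ne_zero _) hpow, Real.log_exp, Real.log_pow]
  push_cast
  ring

lemma tendsto_log_F_div (lam : ℝ) :
    Tendsto (fun L : ℕ => Real.log (F lam L) / L) atTop (𝓝 (U lam)) := by
  have hbounded := (((Real.continuousAt_log one_ne_zero).tendsto.comp
    (tendsto_scaled_F lam)).sub_const lam).sub_const (2 * Real.log (y lam))
  have hlim := (hbounded.div_atTop tendsto_natCast_atTop_atTop).sub_const (Real.log (y lam))
  rw [zero_sub] at hlim
  refine hlim.congr' ?_
  filter_upwards [eventually_ne_atTop 0] with L hL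
  have hL' : (L : ℝ) ≠ 0 := Nat.cast_ne_zero.2 hL
  rw [log_F, Function.comp_apply]
  field_simp
  ring

end RealParameter

section ArctanSeries

open Complex

variable {s t : ℂ}

lemma hasDerivAt_arctan (ht : ‖t‖ < 1) : HasDerivAt arctan (1 + t ^ 2)⁻¹ t := by
  have hadd : 1 + t * I ∈ slitPlane := mem_slitPlane_of_norm_lt_one (by simpa)
  have hsub : 1 - t * I ∈ slitPlane := by
    rw [sub_eq_add_neg]
    exact mem_slitPlane_of_norm_lt_one (by simpa)
  have hlin : HasDerivAt (fun u => u * I) I t := by simpa using (hasDerivAt_id t).mul_const I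
  have hlogs := (((hlin.const_add 1).clog hadd).fun_add
    ((hlin.const_sub 1).clog hsub).fun_neg).const_mul (-I / 2)
  have hcongr : arctan =ᶠ[𝓝 t] fun u => -I / 2 * (log (1 + u * I) + -log (1 - u * I)) := by
    filter_upwards [(isOpen_lt continuous_norm continuous_const).mem_nhds ht] with u hu
    rw [hasSum_arctan_aux hu, arctan]
  refine (hlogs.congr_of_eventuallyEq hcongr).congr_deriv ?_
  have hfactor : (1 + t * I) * (1 - t * I) = 1 + t ^ 2 := by linear_combination (-t ^ 2) * I_sq
  rw [neg_div (1 - t * I), neg_neg,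
    div_add_div _ _ (slitPlane_ne_zero hadd) (slitPlane_ne_zero hsub), hfactor, mul_div_assoc',
    ← one_div]
  congr 1
  linear_combination -I_sq

/-- The power series with `t * arctanSeries (t ^ 2) = arctan t`; unlike `arctan t / t`, it needs no
choice of a square root of `t ^ 2`. -/
def arctanSeries (s : ℂ) : ℂ := ∑' n : ℕ, (-s) ^ n / (2 * n + 1)

lemma arctan_eq_mul_arctanSeries (ht : ‖t‖ < 1) : arctan t = t * arctanSeries (t ^ 2) := by
  rw [← (hasSum_arctan ht).tsum_eq, arctanSeries, ← tsum_mul_left]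
  refine tsum_congr fun n => ?_
  rw [neg_pow (t ^ 2), ← pow_mul]
  push_cast
  ring

lemma arctanSeries_zero : arctanSeries 0 = 1 := by
  rw [arctanSeries, tsum_eq_single 0 fun n hn => by simp [hn]]
  simp

lemma differentiableAt_arctanSeries (hs : ‖s‖ < 1) : DifferentiableAt ℂ arctanSeries s := by
  obtain ⟨r, hsr, hr⟩ := exists_between hs
  refine DifferentiableOn.differentiableAt ?_
    (Metric.isOpen_ball.mem_nhds (mem_ball_zero_iff.2 hsr))
  refine differentiableOn_tsum_of_summable_norm
    (summable_geometric_of_lt_one ((norm_nonneg s).trans hsr.le) hr) (fun n => by fun_prop)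
    Metric.isOpen_ball fun n w hw => ?_
  have hcast : ((2 * n + 1 : ℕ) : ℂ) = 2 * n + 1 := by push_cast; rfl
  rw [norm_div, norm_pow, norm_neg, ← hcast, norm_natCast]
  refine (div_le_self (by positivity) (mod_cast Nat.le_add_left 1 (2 * n))).trans ?_
  exact pow_le_pow_left₀ (norm_nonneg w) (mem_ball_zero_iff.1 hw).le n

lemma norm_lt_one_of_sq_eq (hts : t ^ 2 = s) (hs : ‖s‖ < 1) : ‖t‖ < 1 := by
  rwa [← hts, norm_pow, sq_lt_one_iff₀ (norm_nonneg t)] at hs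

lemma arctanSeries_ode (hs : ‖s‖ < 1) :
    arctanSeries s + 2 * s * deriv arctanSeries s = (1 + s)⁻¹ := by
  obtain ⟨t, rfl⟩ : ∃ t : ℂ, t ^ 2 = s := IsAlgClosed.exists_pow_nat_eq s two_pos
  have ht : ‖t‖ < 1 := norm_lt_one_of_sq_eq rfl hs
  have hseries : HasDerivAt (fun u => arctanSeries (u ^ 2))
      (deriv arctanSeries (t ^ 2) * (2 * t)) t :=
    HasDerivAt.comp (h₂ := arctanSeries) t (differentiableAt_arctanSeries hs).hasDerivAt
      (by simpa using hasDerivAt_pow 2 t)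
  have hcongr : (fun u => u * arctanSeries (u ^ 2)) =ᶠ[𝓝 t] arctan := by
    filter_upwards [(isOpen_lt continuous_norm continuous_const).mem_nhds ht] with u hu
    exact (arctan_eq_mul_arctanSeries hu).symm
  have hderiv := ((hasDerivAt_arctan ht).congr_of_eventuallyEq hcongr).unique
    ((hasDerivAt_id' t).fun_mul hseries)
  linear_combination -hderiv

end ArctanSeries

section ComplexParameter

open Complex

variable {lam : ℂ}

/-- The holomorphic extension of `y` to a complex neighbourhood of `0`. -/
def yExt (lam : ℂ) : ℂ := exp (-lam) * arctanSeries (exp (-lam) - 1)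

lemma yExt_eq_one (h : exp (-lam) = 1) : yExt lam = 1 := by
  rw [yExt, h, sub_self, arctanSeries_zero, one_mul]

lemma yExt_zero : yExt 0 = 1 := yExt_eq_one (by simp)

lemma arctan_div_eq_yExt {t : ℂ} (ht : t ≠ 0) (hsq : t ^ 2 = exp (-lam) - 1)
    (h : ‖exp (-lam) - 1‖ < 1) : arctan t / (exp lam * t) = yExt lam := by
  rw [arctan_eq_mul_arctanSeries (norm_lt_one_of_sq_eq hsq h), yExt, hsq, exp_neg]
  field_simp

lemma exists_isRiccatiPole_yExt (h : ‖exp (-lam) - 1‖ < 1) :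
    ∃ Λ, IsRiccatiPole (exp lam) Λ (yExt lam) := by
  obtain ⟨t, hsq⟩ : ∃ t : ℂ, t ^ 2 = exp (-lam) - 1 := IsAlgClosed.exists_pow_nat_eq _ two_pos
  rcases eq_or_ne t 0 with rfl | ht
  · have hexp : exp (-lam) = 1 := by linear_combination -hsq
    refine ⟨0, ?_⟩
    rw [yExt_eq_one hexp, ← inv_inv (exp lam), ← exp_neg, hexp, inv_one]
    exact isRiccatiPole_one
  · refine ⟨exp lam * t, ?_⟩
    rw [← arctan_div_eq_yExt ht hsq h]
    refine isRiccatiPole_arctan ?_ ht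
    rw [hsq, add_sub_cancel, ← exp_add, add_neg_cancel, exp_zero]

lemma ofReal_y_eq_yExt {t : ℝ} (h : ‖exp (-(t : ℂ)) - 1‖ < 1) : (y t : ℂ) = yExt t := by
  rcases eq_or_ne t 0 with rfl | ht
  · rw [y_zero, ofReal_zero, yExt_zero, ofReal_one]
  · rw [ofReal_y ht, ← exp_mul_arctanArg]
    refine arctan_div_eq_yExt (arctanArg_ne_zero ht) ?_ h
    rw [arctanArg_sq]
    push_cast
    rfl

lemma differentiableAt_yExt (h : ‖exp (-lam) - 1‖ < 1) : DifferentiableAt ℂ yExt lam :=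
  DifferentiableAt.fun_mul (by fun_prop)
    ((differentiableAt_arctanSeries h).fun_comp' lam (by fun_prop))

lemma yExt_ode (h : ‖exp (-lam) - 1‖ < 1) :
    2 * (exp lam * (yExt lam + deriv yExt lam)) - yExt lam - 2 * deriv yExt lam = 1 := by
  have hexp_neg : HasDerivAt (fun u => exp (-u)) (-exp (-lam)) lam := by
    simpa using (hasDerivAt_neg lam).cexp
  have hseries : HasDerivAt (fun u => arctanSeries (exp (-u) - 1))
      (deriv arctanSeries (exp (-lam) - 1) * -exp (-lam)) lam :=
    HasDerivAt.comp (h₂ := arctanSeries) lam (differentiableAt_arctanSeries h).hasDerivAt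
      (hexp_neg.sub_const 1)
  have hyExt : HasDerivAt yExt _ lam := hexp_neg.fun_mul hseries
  have hode := arctanSeries_ode h
  rw [add_sub_cancel] at hode
  rw [hyExt.deriv, yExt]
  have hexp : exp lam = (exp (-lam))⁻¹ := by rw [exp_neg, inv_inv]
  have hne := exp_ne_zero (-lam)
  field_simp at hode
  rw [hexp]
  field_simp
  linear_combination hode

/-- A neighbourhood of `0` on which the asymptotics of `⟨e^{λN}⟩` is uniform. -/
def nearZero : Set ℂ := {lam | ‖lam‖ < 1 ∧ ‖exp (-lam) - 1‖ < 1 / 64 ∧ ‖yExt lam - 1‖ < 1 / 4}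

lemma nearZero_mem_nhds : nearZero ∈ 𝓝 (0 : ℂ) := by
  have hyExt : ContinuousAt yExt 0 := (differentiableAt_yExt (by simp)).continuousAt
  have hnorm : ∀ᶠ lam in 𝓝 (0 : ℂ), ‖lam‖ < 1 :=
    ContinuousAt.eventually_lt (by fun_prop) continuousAt_const (by simp)
  have hexp : ∀ᶠ lam in 𝓝 (0 : ℂ), ‖exp (-lam) - 1‖ < 1 / 64 :=
    ContinuousAt.eventually_lt (by fun_prop) continuousAt_const (by simp)
  have hyExt_sub : ∀ᶠ lam in 𝓝 (0 : ℂ), ‖yExt lam - 1‖ < 1 / 4 :=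
    ContinuousAt.eventually_lt (by fun_prop) continuousAt_const (by simp [yExt_zero])
  exact hnorm.and (hexp.and hyExt_sub)

lemma norm_exp_neg_sub_one_lt_one (h : lam ∈ nearZero) : ‖exp (-lam) - 1‖ < 1 :=
  h.2.1.trans (by norm_num)

lemma yExt_mem_slitPlane (h : lam ∈ nearZero) : yExt lam ∈ slitPlane := by
  simpa using mem_slitPlane_of_norm_lt_one (h.2.2.trans (by norm_num))

lemma norm_exp_le_two (h : lam ∈ nearZero) : ‖exp lam‖ ≤ 2 := by
  have hneg : 1 / 2 ≤ ‖exp (-lam)‖ := by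
    have htri := norm_sub_norm_le (1 : ℂ) (exp (-lam))
    rw [norm_one, norm_sub_rev] at htri
    linarith [h.2.1]
  rw [← inv_inv (exp lam), ← exp_neg, norm_inv]
  exact inv_le_of_inv_le₀ two_pos (by linarith)

lemma norm_inv_exp_le_two (h : lam ∈ nearZero) : ‖(exp lam)⁻¹‖ ≤ 2 := by
  rw [← exp_neg]
  linarith [norm_le_norm_sub_add (exp (-lam)) 1, h.2.1, norm_one (α := ℂ)]

lemma IsRiccatiPole.norm_le_of_mem_nearZero {Λ y : ℂ} (H : IsRiccatiPole (exp lam) Λ y)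
    (h : lam ∈ nearZero) : ‖Λ‖ ≤ 1 / 4 := by
  have hsq : Λ ^ 2 = exp lam ^ 2 * (exp (-lam) - 1) := by
    rw [H.sq_eq, exp_neg]
    field_simp
  refine le_of_sq_le_sq ?_ (by norm_num)
  calc ‖Λ‖ ^ 2 = ‖exp lam‖ ^ 2 * ‖exp (-lam) - 1‖ := by rw [← norm_pow, hsq, norm_mul, norm_pow]
    _ ≤ 2 ^ 2 * (1 / 64) := by
      gcongr
      · exact norm_exp_le_two h
      · exact h.2.1.le
    _ = (1 / 4) ^ 2 := by norm_num

lemma exists_norm_cotRemainder_le : ∃ B, ∀ w : ℂ, ‖w‖ ≤ 1 → ‖cotRemainder w‖ ≤ B := by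
  obtain ⟨B, hB⟩ := (isCompact_closedBall (0 : ℂ) 1).exists_bound_of_continuousOn fun w hw =>
    (differentiableAt_cotRemainder (csinc_ne_zero_of_norm_le_one
      (mem_closedBall_zero_iff.1 hw))).continuousAt.continuousWithinAt
  exact ⟨B, fun w hw => hB w (mem_closedBall_zero_iff.2 hw)⟩

lemma exists_norm_scaled_riccatiCoeff_sub_one_le : ∃ C, ∀ z Λ y : ℂ, IsRiccatiPole z Λ y →
    ‖z‖ ≤ 2 → ‖z⁻¹‖ ≤ 2 → ‖Λ‖ ≤ 1 / 4 → ‖y‖ ≤ 5 / 4 →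
      ∀ n : ℕ, ‖z * y ^ (n + 1) * riccatiCoeff z n - 1‖ ≤ C * (5 / 8) ^ n := by
  obtain ⟨B, hB⟩ := exists_norm_cotRemainder_le
  have hB_nonneg : 0 ≤ B := (norm_nonneg _).trans (hB 0 (by simp))
  refine ⟨2 * (5 / 4) * (2 * (1 / 4) * B), fun z Λ y H hz hz_inv hΛ hy n => ?_⟩
  have hball : ∀ x : ℂ, ‖x‖ ≤ 2 → ‖Λ * (y - x)‖ ≤ 1 := fun x hx =>
    calc ‖Λ * (y - x)‖ = ‖Λ‖ * ‖y - x‖ := norm_mul _ _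
      _ ≤ 1 / 4 * 4 := by
        gcongr
        exact (norm_sub_le y x).trans (by linarith)
      _ = 1 := by norm_num
  have hregular : ∀ x : ℂ, ‖x‖ = 2 → ‖riccatiRegularPart z Λ y x‖ ≤ 2 * (1 / 4) * B := by
    intro x hx
    rw [riccatiRegularPart, norm_mul, norm_mul]
    gcongr
    exact hB _ (hball x hx.le)
  have hratio : ‖y‖ / 2 ≤ 5 / 8 := by linarith
  refine (H.norm_scaled_riccatiCoeff_sub_one_le two_pos
    (fun x hx => csinc_ne_zero_of_norm_le_one (hball x hx)) hregular n).trans ?_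
  gcongr

end ComplexParameter

section HolomorphicExtension

open Complex

lemma analyticAt_of_eventually_ofReal_eq {g : ℂ → ℂ} {h : ℝ → ℝ} {t : ℝ} (hg : AnalyticAt ℂ g t)
    (hgh : ∀ᶠ s : ℝ in 𝓝 t, (h s : ℂ) = g s) : AnalyticAt ℝ h t :=
  hg.re_ofReal.congr (hgh.mono fun s hs => by simp only [← hs, ofReal_re])

lemma ofReal_iteratedDeriv {g : ℂ → ℂ} {h : ℝ → ℝ} {t : ℝ} (hg : AnalyticAt ℂ g t)
    (hgh : ∀ᶠ s : ℝ in 𝓝 t, (h s : ℂ) = g s) (n : ℕ) :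
    ((iteratedDeriv n h t : ℝ) : ℂ) = iteratedDeriv n g t := by
  induction n generalizing g h with
  | zero => simpa only [iteratedDeriv_zero] using hgh.self_of_nhds
  | succ n ih =>
    rw [iteratedDeriv_succ', iteratedDeriv_succ']
    refine ih hg.deriv ?_
    filter_upwards [hgh.eventually_nhds,
      continuous_ofReal.continuousAt.eventually hg.eventually_analyticAt] with s hs hgs
    have hh : HasDerivAt h (deriv h s) s :=
      (analyticAt_of_eventually_ofReal_eq hgs hs).differentiableAt.hasDerivAt
    exact hh.ofReal_comp.unique
      (hgs.differentiableAt.hasDerivAt.comp_ofReal.congr_of_eventuallyEq hs)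

lemma tendsto_iteratedDeriv {G : ℕ → ℂ → ℂ} {g : ℂ → ℂ} {V : Set ℂ} {x : ℂ} (hV : IsOpen V)
    (hlim : TendstoLocallyUniformlyOn G g atTop V)
    (hG : ∀ᶠ L in atTop, DifferentiableOn ℂ (G L) V) (n : ℕ) (hx : x ∈ V) :
    Tendsto (fun L => iteratedDeriv n (G L) x) atTop (𝓝 (iteratedDeriv n g x)) := by
  induction n generalizing G g with
  | zero => simpa only [iteratedDeriv_zero] using hlim.tendsto_at hx
  | succ n ih =>
    simp only [iteratedDeriv_succ']
    exact ih (hlim.deriv hG hV) (hG.mono fun L hL => hL.deriv hV)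

end HolomorphicExtension

section TaylorCoefficients

open Complex

variable {t : ℝ}

lemma eventually_norm_exp_neg_sub_one_lt {lam : ℂ} (h : ‖exp (-lam) - 1‖ < 1) :
    ∀ᶠ u in 𝓝 lam, ‖exp (-u) - 1‖ < 1 :=
  ContinuousAt.eventually_lt (by fun_prop) continuousAt_const h

lemma analyticAt_yExt {lam : ℂ} (h : ‖exp (-lam) - 1‖ < 1) : AnalyticAt ℂ yExt lam :=
  analyticAt_iff_eventually_differentiableAt.2 <|
    (eventually_norm_exp_neg_sub_one_lt h).mono fun _ hu => differentiableAt_yExt hu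

lemma eventually_ofReal_y_eq_yExt (h : ‖exp (-(t : ℂ)) - 1‖ < 1) :
    ∀ᶠ u : ℝ in 𝓝 t, (y u : ℂ) = yExt u :=
  (continuous_ofReal.continuousAt.eventually (eventually_norm_exp_neg_sub_one_lt h)).mono
    fun _ hu => ofReal_y_eq_yExt hu

lemma analyticAt_y (h : ‖exp (-(t : ℂ)) - 1‖ < 1) : AnalyticAt ℝ y t :=
  analyticAt_of_eventually_ofReal_eq (analyticAt_yExt h) (eventually_ofReal_y_eq_yExt h)

lemma y_ode (h : ‖exp (-(t : ℂ)) - 1‖ < 1) :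
    2 * ((y t + deriv y t) * Real.exp t) - y t - 2 * deriv y t = 1 := by
  have hderiv : ((deriv y t : ℝ) : ℂ) = deriv yExt t := by
    simpa only [iteratedDeriv_one] using
      ofReal_iteratedDeriv (analyticAt_yExt h) (eventually_ofReal_y_eq_yExt h) 1
  rw [← ofReal_inj]
  push_cast
  rw [hderiv, ofReal_y_eq_yExt h, mul_comm _ (exp t)]
  exact yExt_ode h

lemma analyticAt_y_zero : AnalyticAt ℝ y 0 := analyticAt_y (by simp)

lemma tendsto_y : Tendsto y (𝓝[≠] 0) (𝓝 (y 0)) :=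
  analyticAt_y_zero.continuousAt.tendsto.mono_left nhdsWithin_le_nhds

lemma analyticAt_U : AnalyticAt ℝ U 0 := (analyticAt_y_zero.log (y_pos 0)).neg

lemma sum_iteratedDeriv_y (n : ℕ) :
    2 * ∑ i ∈ Finset.range (n + 1),
        (n.choose i : ℝ) * (iteratedDeriv i y 0 + iteratedDeriv (i + 1) y 0)
      - iteratedDeriv n y 0 - 2 * iteratedDeriv (n + 1) y 0 = if n = 0 then 1 else 0 := by
  have hode : (fun t => 2 * ((y t + deriv y t) * Real.exp t) - y t - 2 * deriv y t)
      =ᶠ[𝓝 0] fun _ => 1 :=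
    (continuous_ofReal.continuousAt.eventually
      (eventually_norm_exp_neg_sub_one_lt (by simp))).mono fun t ht => y_ode ht
  have hy (m : ℕ) : ContDiffAt ℝ m y 0 := analyticAt_y_zero.contDiffAt
  have hy' (m : ℕ) : ContDiffAt ℝ m (deriv y) 0 := analyticAt_y_zero.deriv.contDiffAt
  have hexp : ContDiffAt ℝ n Real.exp 0 := Real.contDiff_exp.contDiffAt
  have hprod : ContDiffAt ℝ n (fun t => (y t + deriv y t) * Real.exp t) 0 :=
    ((hy n).add (hy' n)).mul hexp
  have hexp_zero (m : ℕ) : iteratedDeriv m Real.exp 0 = 1 := by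
    rw [iteratedDeriv_eq_iterate, Real.iter_deriv_exp, Real.exp_zero]
  have hsum (i : ℕ) : iteratedDeriv i (fun t => y t + deriv y t) 0
      = iteratedDeriv i y 0 + iteratedDeriv (i + 1) y 0 := by
    rw [iteratedDeriv_fun_add (hy i) (hy' i), iteratedDeriv_succ']
  have hleibniz := hode.iteratedDeriv_eq n
  rw [iteratedDeriv_fun_sub ((contDiffAt_const.mul hprod).sub (hy n))
      (contDiffAt_const.mul (hy' n)),
    iteratedDeriv_fun_sub (contDiffAt_const.mul hprod) (hy n), iteratedDeriv_const_mul_field,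
    iteratedDeriv_const_mul_field, iteratedDeriv_fun_mul ((hy n).add (hy' n)) hexp,
    iteratedDeriv_const, ← iteratedDeriv_succ'] at hleibniz
  simpa only [hsum, hexp_zero, mul_one] using hleibniz

lemma iteratedDeriv_y : iteratedDeriv 1 y 0 = -2 / 3 ∧ iteratedDeriv 2 y 0 = 2 / 5 ∧
    iteratedDeriv 3 y 0 = -22 / 105 ∧ iteratedDeriv 4 y 0 = 2 / 21 := by
  have h₁ := sum_iteratedDeriv_y 1
  have h₂ := sum_iteratedDeriv_y 2
  have h₃ := sum_iteratedDeriv_y 3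
  have h₄ := sum_iteratedDeriv_y 4
  norm_num [Finset.sum_range_succ, Nat.choose, y_zero] at h₁ h₂ h₃ h₄
  rw [iteratedDeriv_one]
  refine ⟨?_, ?_, ?_, ?_⟩ <;> linarith

lemma sum_iteratedDeriv_U_mul (n : ℕ) :
    ∑ i ∈ Finset.range (n + 1), (n.choose i : ℝ) * iteratedDeriv (i + 1) U 0
      * iteratedDeriv (n - i) y 0 = -iteratedDeriv (n + 1) y 0 := by
  have hderiv : (fun t => deriv U t * y t) =ᶠ[𝓝 0] fun t => -deriv y t := by
    filter_upwards [analyticAt_y_zero.eventually_analyticAt] with t ht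
    have hU : HasDerivAt U _ t := (ht.differentiableAt.hasDerivAt.log (y_pos t).ne').neg
    rw [hU.deriv, neg_mul, div_mul_cancel₀ _ (y_pos t).ne']
  have hleibniz := hderiv.iteratedDeriv_eq n
  rw [iteratedDeriv_fun_mul analyticAt_U.deriv.contDiffAt analyticAt_y_zero.contDiffAt,
    iteratedDeriv_fun_neg] at hleibniz
  simpa only [iteratedDeriv_succ'] using hleibniz

lemma iteratedDeriv_U : iteratedDeriv 1 U 0 = 2 / 3 ∧ iteratedDeriv 2 U 0 = 2 / 45 ∧
    iteratedDeriv 3 U 0 = 2 / 945 ∧ iteratedDeriv 4 U 0 = -22 / 4725 := by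
  obtain ⟨hy₁, hy₂, hy₃, hy₄⟩ := iteratedDeriv_y
  have h₀ := sum_iteratedDeriv_U_mul 0
  have h₁ := sum_iteratedDeriv_U_mul 1
  have h₂ := sum_iteratedDeriv_U_mul 2
  have h₃ := sum_iteratedDeriv_U_mul 3
  rw [iteratedDeriv_one] at hy₁ ⊢
  norm_num [Finset.sum_range_succ, Nat.choose, y_zero, hy₁, hy₂, hy₃, hy₄] at h₀ h₁ h₂ h₃
  refine ⟨?_, ?_, ?_, ?_⟩ <;> linarith

end TaylorCoefficients

section Cumulants

open Complex

variable {lam : ℂ} {L : ℕ}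

/-- The holomorphic extension of `U` to a complex neighbourhood of `0`. -/
def UExt (lam : ℂ) : ℂ := -log (yExt lam)

lemma differentiableAt_log_yExt (h : lam ∈ nearZero) :
    DifferentiableAt ℂ (fun u => log (yExt u)) lam :=
  (differentiableAt_yExt (norm_exp_neg_sub_one_lt_one h)).clog (yExt_mem_slitPlane h)

lemma analyticAt_UExt : AnalyticAt ℂ UExt 0 :=
  analyticAt_iff_eventually_differentiableAt.2 <|
    (eventually_mem_set.2 nearZero_mem_nhds).mono fun _ h => (differentiableAt_log_yExt h).neg

lemma eventually_ofReal_U_eq_UExt : ∀ᶠ t : ℝ in 𝓝 0, (U t : ℂ) = UExt t := by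
  filter_upwards [eventually_ofReal_y_eq_yExt (t := 0) (by simp)] with t ht
  rw [U, UExt, ← ht, ofReal_neg, ofReal_log (y_pos t).le]

/-- `⟨e^{λN}⟩` divided by its leading asymptotics, for complex `λ`. -/
def scaledMGF (L : ℕ) (lam : ℂ) : ℂ :=
  exp lam * yExt lam ^ (L + 2) * riccatiCoeff (exp lam) (L + 1)

lemma differentiable_riccatiCoeff (n : ℕ) : Differentiable ℂ fun z => riccatiCoeff z n := by
  induction n using Nat.strong_induction_on with
  | _ n ih =>
    rcases n with _ | n
    · simpa only [riccatiCoeff_zero] using differentiable_const 1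
    · simp only [riccatiCoeff_succ]
      refine ((differentiable_id.mul (Differentiable.fun_sum fun k hk => ?_)).add ?_).div_const _
      · rw [Finset.mem_range] at hk
        exact (ih k hk).mul (ih (n - k) (by omega))
      · split_ifs <;> fun_prop

lemma differentiableAt_scaledMGF (h : lam ∈ nearZero) : DifferentiableAt ℂ (scaledMGF L) lam :=
  (differentiableAt_exp.mul
    ((differentiableAt_yExt (norm_exp_neg_sub_one_lt_one h)).pow (L + 2))).mul
    ((differentiable_riccatiCoeff (L + 1) _).comp lam differentiableAt_exp)

lemma exists_norm_scaledMGF_sub_one_le :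
    ∃ C, ∀ L, ∀ lam ∈ nearZero, ‖scaledMGF L lam - 1‖ ≤ C * (5 / 8) ^ (L + 1) := by
  obtain ⟨C, hC⟩ := exists_norm_scaled_riccatiCoeff_sub_one_le
  refine ⟨C, fun L lam h => ?_⟩
  obtain ⟨Λ, H⟩ := exists_isRiccatiPole_yExt (norm_exp_neg_sub_one_lt_one h)
  refine hC _ Λ _ H (norm_exp_le_two h) (norm_inv_exp_le_two h) (H.norm_le_of_mem_nearZero h) ?_ _
  linarith [norm_le_norm_sub_add (yExt lam) 1, h.2.2, norm_one (α := ℂ)]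

lemma eventually_norm_scaledMGF_sub_one_le :
    ∀ᶠ L in atTop, ∀ lam ∈ nearZero, ‖scaledMGF L lam - 1‖ ≤ 1 / 2 := by
  obtain ⟨C, hC⟩ := exists_norm_scaledMGF_sub_one_le
  have hgeom : Tendsto (fun L : ℕ => C * (5 / 8 : ℝ) ^ (L + 1)) atTop (𝓝 0) := by
    simpa only [mul_zero, Function.comp_def] using (((tendsto_pow_atTop_nhds_zero_of_lt_one
      (by norm_num) (by norm_num)).comp (tendsto_add_atTop_nat 1)).const_mul C)
  filter_upwards [hgeom.eventually_le_const one_half_pos] with L hL lam h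
  exact (hC L lam h).trans hL

/-- The holomorphic extension of `ln ⟨e^{λN}⟩` to a complex neighbourhood of `0`; it is written
with `scaledMGF`, which stays near `1`, to avoid the branch cut of the logarithm. -/
def cgfExt (L : ℕ) (lam : ℂ) : ℂ := log (scaledMGF L lam) - lam - (L + 2) * log (yExt lam)

lemma differentiableAt_cgfExt (h : lam ∈ nearZero) (hscaled : ‖scaledMGF L lam - 1‖ ≤ 1 / 2) :
    DifferentiableAt ℂ (cgfExt L) lam := by
  have hslit : scaledMGF L lam ∈ slitPlane := by
    simpa using mem_slitPlane_of_norm_lt_one (hscaled.trans_lt one_half_lt_one)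
  exact (((differentiableAt_scaledMGF h).clog hslit).sub differentiableAt_id).sub
    ((differentiableAt_log_yExt h).const_mul _)

lemma norm_cgfExt_div_sub_UExt_le (hL : L ≠ 0) (h : lam ∈ nearZero)
    (hscaled : ‖scaledMGF L lam - 1‖ ≤ 1 / 2) : ‖cgfExt L lam / L - UExt lam‖ ≤ 3 / L := by
  have hL' : (L : ℂ) ≠ 0 := Nat.cast_ne_zero.2 hL
  have hsplit : cgfExt L lam / L - UExt lam
      = (log (scaledMGF L lam) - lam - 2 * log (yExt lam)) / L := by
    rw [cgfExt, UExt]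
    field_simp
    ring
  have hlog_scaled := norm_log_one_add_half_le_self hscaled
  have hlog_yExt := norm_log_one_add_half_le_self (h.2.2.le.trans (by norm_num))
  rw [add_sub_cancel] at hlog_scaled hlog_yExt
  rw [hsplit, norm_div, norm_natCast]
  gcongr
  calc ‖log (scaledMGF L lam) - lam - 2 * log (yExt lam)‖
      ≤ ‖log (scaledMGF L lam)‖ + ‖lam‖ + 2 * ‖log (yExt lam)‖ := by
        refine (norm_sub_le _ _).trans (add_le_add (norm_sub_le _ _) ?_)
        rw [norm_mul, norm_ofNat]
    _ ≤ 3 := by linarith [h.1, h.2.2]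

lemma tendstoUniformlyOn_cgfExt_div :
    TendstoUniformlyOn (fun (L : ℕ) lam => cgfExt L lam / L) UExt atTop nearZero := by
  rw [Metric.tendstoUniformlyOn_iff]
  intro ε hε
  have hlim : Tendsto (fun L : ℕ => (3 : ℝ) / L) atTop (𝓝 0) :=
    tendsto_const_nhds.div_atTop tendsto_natCast_atTop_atTop
  filter_upwards [eventually_norm_scaledMGF_sub_one_le, hlim.eventually_lt_const hε,
    eventually_ne_atTop 0] with L hscaled hL_lt hL lam h
  rw [dist_comm, dist_eq_norm]
  exact (norm_cgfExt_div_sub_UExt_le hL h (hscaled lam h)).trans_lt hL_lt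

lemma eventually_ofReal_cgf_eq_cgfExt (L : ℕ) :
    ∀ᶠ t : ℝ in 𝓝 0, (cgf count (countLaw L) t : ℂ) = cgfExt L t := by
  filter_upwards [eventually_ofReal_y_eq_yExt (t := 0) (by simp)] with t ht
  have hscaled : scaledMGF L t = (Real.exp t * y t ^ (L + 2) * F t L : ℝ) := by
    rw [scaledMGF, ← ht, ← ofReal_F_sub_one, Nat.add_sub_cancel]
    push_cast
    rfl
  have hnonneg : 0 ≤ Real.exp t * y t ^ (L + 2) * F t L := by
    have := y_pos t
    have := F_pos t L
    positivity
  rw [cgf, ← F, log_F, cgfExt, hscaled, ← ht, ← ofReal_log hnonneg, ← ofReal_log (y_pos t).le]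
  push_cast
  rfl

lemma tendsto_cumulant (n : ℕ) :
    Tendsto (fun L : ℕ => cumulant n count (countLaw L) / L) atTop (𝓝 (iteratedDeriv n U 0)) := by
  have hdiff : ∀ᶠ L : ℕ in atTop, ∀ lam ∈ nearZero, DifferentiableAt ℂ (cgfExt L) lam :=
    eventually_norm_scaledMGF_sub_one_le.mono fun L hL lam h => differentiableAt_cgfExt h (hL lam h)
  have hlim := tendsto_iteratedDeriv (x := 0) isOpen_interior
    (tendstoUniformlyOn_cgfExt_div.mono interior_subset).tendstoLocallyUniformlyOn
    (hdiff.mono fun L hL lam h =>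
      ((hL lam (interior_subset h)).div_const (L : ℂ)).differentiableWithinAt) n
    (mem_interior_iff_mem_nhds.2 nearZero_mem_nhds)
  rw [← ofReal_zero, ← ofReal_iteratedDeriv (ofReal_zero ▸ analyticAt_UExt)
    eventually_ofReal_U_eq_UExt] at hlim
  rw [← tendsto_ofReal_iff]
  refine hlim.congr' ?_
  filter_upwards [hdiff] with L hL
  have hanalytic : AnalyticAt ℂ (cgfExt L) (0 : ℝ) := by
    rw [ofReal_zero]
    exact analyticAt_iff_eventually_differentiableAt.2 (mem_of_superset nearZero_mem_nhds hL)
  rw [iteratedDeriv_div_const, ← ofReal_iteratedDeriv hanalytic (eventually_ofReal_cgf_eq_cgfExt L),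
    cumulant, ofReal_div, ofReal_natCast]

lemma integrableExpSet_count (L : ℕ) : integrableExpSet count (countLaw L) = Set.univ :=
  Set.eq_univ_of_forall fun t => integrable_exp_count L t

lemma cumulant_one (L : ℕ) : cumulant 1 count (countLaw L) = ∫ n, count n ∂(countLaw L) := by
  rw [cumulant, iteratedDeriv_one, deriv_cgf_zero (by simp [integrableExpSet_count]),
    probReal_univ, div_one]

lemma cumulant_two (L : ℕ) : cumulant 2 count (countLaw L) = Var[count; countLaw L] := by
  have hmem : (0 : ℝ) ∈ interior (integrableExpSet count (countLaw L)) := by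
    simp [integrableExpSet_count]
  rw [cumulant, iteratedDeriv_two_cgf_eq_integral hmem, deriv_cgf_zero hmem,
    variance_eq_integral (measurable_of_countable _).aemeasurable]
  simp

lemma tendsto_mean_div :
    Tendsto (fun L : ℕ => (∫ n, count n ∂(countLaw L)) / L) atTop (𝓝 (2 / 3)) := by
  simpa only [cumulant_one, iteratedDeriv_U.1] using tendsto_cumulant 1

lemma tendsto_variance_div :
    Tendsto (fun L : ℕ => Var[count; countLaw L] / L) atTop (𝓝 (2 / 45)) := by
  simpa only [cumulant_two, iteratedDeriv_U.2.1] using tendsto_cumulant 2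

lemma tendsto_mandelQ : Tendsto mandelQ atTop (𝓝 (-14 / 15)) := by
  have hlim := (tendsto_variance_div.div tendsto_mean_div (by norm_num)).sub_const 1
  rw [show (2 / 45 / (2 / 3) - 1 : ℝ) = -14 / 15 by norm_num] at hlim
  refine hlim.congr' ?_
  filter_upwards [eventually_ne_atTop 0] with L hL
  rw [mandelQ, Pi.div_apply, div_div_div_cancel_right₀ (Nat.cast_ne_zero.2 hL)]

end Cumulants

end DimerCovering

end

open DimerCovering in
theorem mainTheorem3 :
    -- all exponential moments of `N` are finite
    (∀ (L : ℕ) (lam : ℝ), Integrable (fun n => Real.exp (lam * count n)) (countLaw L)) ∧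
    -- `y(λ)` is a positive real number, given by the arctangent formula, with `y(λ) → y(0) = 1`
    (∀ lam : ℝ, 0 < y lam) ∧
    (∀ lam : ℝ, lam ≠ 0 →
      (y lam : ℂ) = Complex.arctan (Complex.exp (-lam / 2) * root lam) / Lam lam) ∧
    Tendsto y (𝓝[≠] 0) (𝓝 (y 0)) ∧
    -- closed form of the generating function in the disc `|x| < y(λ)`
    (∀ lam : ℝ, lam ≠ 0 → ∀ x : ℂ, ‖x‖ < y lam → Complex.cos (Lam lam * x) ≠ 0 →
      Lam lam - Complex.exp lam * Complex.tan (Lam lam * x) ≠ 0 ∧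
      HasSum (fun L : ℕ => (F lam L : ℂ) * x ^ (L + 1)) (closedForm lam x)) ∧
    (∀ x : ℂ, ‖x‖ < y 0 →
      HasSum (fun L : ℕ => (F 0 L : ℂ) * x ^ (L + 1)) (x / (1 - x)) ∧
      Tendsto (fun lam : ℝ => closedForm lam x) (𝓝[≠] 0) (𝓝 (x / (1 - x)))) ∧
    -- `y(λ)` is a simple pole of the generating function
    (∀ lam : ℝ, lam ≠ 0 → meromorphicOrderAt (closedForm lam) (y lam : ℂ) = ((-1 : ℤ) : WithTop ℤ)) ∧
    meromorphicOrderAt (fun x : ℂ => x / (1 - x)) (y 0 : ℂ) = ((-1 : ℤ) : WithTop ℤ) ∧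
    -- the cumulant generating function per site
    (∀ lam : ℝ, Tendsto (fun L : ℕ => Real.log (F lam L) / L) atTop (𝓝 (U lam))) ∧
    -- linear growth of all cumulants, with the Taylor coefficients of `U` at `0` as rates
    AnalyticAt ℝ U 0 ∧
    (∀ n : ℕ, 1 ≤ n →
      Tendsto (fun L : ℕ => cumulant n count (countLaw L) / L) atTop (𝓝 (iteratedDeriv n U 0))) ∧
    Tendsto (fun L : ℕ => (∫ n, count n ∂(countLaw L)) / L) atTop (𝓝 (2 / 3)) ∧
    Tendsto (fun L : ℕ => Var[count; countLaw L] / L) atTop (𝓝 (2 / 45)) ∧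
    Tendsto (fun L : ℕ => cumulant 3 count (countLaw L) / L) atTop (𝓝 (2 / 945)) ∧
    Tendsto (fun L : ℕ => cumulant 4 count (countLaw L) / L) atTop (𝓝 (-22 / 4725)) ∧
    -- the Mandel parameter
    Tendsto mandelQ atTop (𝓝 (-14 / 15)) := by
  refine ⟨integrable_exp_count, y_pos, fun _ hlam => ofReal_y hlam, tendsto_y,
    fun _ hlam _ hx hcos => hasSum_closedForm hlam hx hcos,
    fun x hx => ⟨hasSum_F_zero hx, tendsto_closedForm (hx.trans_eq y_zero)⟩,
    fun _ hlam => meromorphicOrderAt_closedForm hlam, meromorphicOrderAt_div_one_sub,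
    tendsto_log_F_div, analyticAt_U, fun n _ => tendsto_cumulant n, tendsto_mean_div,
    tendsto_variance_div, ?_, ?_, tendsto_mandelQ⟩
  · simpa only [iteratedDeriv_U.2.2.1] using tendsto_cumulant 3
  · simpa only [iteratedDeriv_U.2.2.2] using tendsto_cumulant 4
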